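/- Let $K$ be a field of characteristic zero with a derivation $\delta$, let $r\le n$, and let $K\{X\}=K[X_j^{(p)} : 1\le j\le n,\ p\ge 0]$ be the ring of differential polynomials in $X_1,\dots,X_n$. For $g\in K\{X\}$ the total derivatives are $g^{(0)}=g$ and $g^{(p)}=\delta(g^{(p-1)})+\sum_{j,q}\frac{\partial g^{(p-1)}}{\partial X_j^{(q)}}X_j^{(q+1)}$, where $\delta$ acts on coefficients. Let $F=(f_1,\dots,f_r)$ with $f_1,\dots,f_r\in K\{X\}$, let $e$ be the maximal derivation order of a variable occurring in $f_1,\dots,f_r$, and assume $e\ge 1$. For $m\ge 0$ put $A_m=K[X_j^{(p)} : 1\le j\le n,\ p\le m]$. An ideal of $K\{X\}$ is called differential if it is stable under the total derivative. Let $\mathfrak P\subset K\{X\}$ be minimal among the prime differential ideals containing $f_1,\dots,f_r$, with residue field $\mathbb K=\mathrm{Frac}(K\{X\}/\mathfrak P)$, and assume that the system is quasi-regular at $\mathfrak P$: for every $i\ge 1$ the Jacobian matrix of the $ri$ polynomials $f_j^{(p)}$ ($1\le j\le r$, $0\le p\le i-1$) with respect to the variables of $A_{i-1+e}$ has full row rank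 over the domain $A_{i-1+e}/(A_{i-1+e}\cap\mathfrak P)$. Let $B_m$ be the localization of $A_m$ at the prime ideal $A_m\cap\mathfrak P$, and for $q\ge 0$ let $\Delta_q$ be the ideal generated by all $f_j^{(p)}$ with $1\le j\le r$ and $0\le p\le q-1$ (so $\Delta_0=(0)$) in the ring $B_{q-1+e}$ (in any $B_m$ if $q=0$). For $k\ge 1$ and $i\ge e-1$ let $\mathfrak J_{k,i}$ be the $kr\times kn$ matrix with $r\times n$ blocks $\partial F^{(i-e+a)}/\partial X^{(i+b)}$, $1\le a,b\le k$ (the blocks with $b>a$ are zero). Assume that for all such $k,i$ the rank of $\mathfrak J_{k,i}$ over the integral domain $B_{i+k+s}/\Delta_{i-e+1+k+s}$ does not depend on $s\ge 0$. Put $\mu_{0,i}=0$ and $\mu_{k,i}=\dim_{\mathbb K}\ker(\mathfrak J_{k,i}^{t})$, computed over $\mathbb K$, for $k\ge 1$. Then for all integers $k\ge 0$ and $i\ge e-1$ the ideal $\Delta_{i-e+1+k}$ of $B_{i+k}$ is prime, and: (i) the field extension $\mathrm{Frac}(B_i/(\Delta_{i-e+1+k}\cap B_i))\hookrightarrow\mathrm{Frac}(B_{i+k}/\Delta_{i-e+1+k})$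 has transcendence degree $k(n-r)+\mu_{k,i}$; (ii) $\mathrm{trdeg}_K\,\mathrm{Frac}(B_i/(\Delta_{i-e+1+k}\cap B_i))=(n-r)(i+1)+er-\mu_{k,i}$. -/

import Mathlib

open MvPolynomial

noncomputable section

namespace DAE

/-- The ring `K{X₁, …, Xₙ}` of differential polynomials: the variable `(j, p)` stands for the
`p`-th derivative `X_j^{(p)}`. -/
abbrev DiffPoly (K : Type*) [Field K] (n : ℕ) : Type _ := MvPolynomial (Fin n × ℕ) K

variable {K : Type*} [Field K] {n r : ℕ}

/-- The polynomial obtained by applying the derivation `δ` of `K` to all coefficients. -/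
def coeffDeriv (δ : Derivation ℤ K K) (g : DiffPoly K n) : DiffPoly K n :=
  ∑ m ∈ g.support, monomial m (δ (coeff m g))

/-- The total derivative `δ(g) + ∑_{j, p} ∂g/∂X_j^{(p)} · X_j^{(p+1)}`; only the variables that
occur in `g` contribute to the sum. -/
def totalDeriv (δ : Derivation ℤ K K) (g : DiffPoly K n) : DiffPoly K n :=
  coeffDeriv δ g + ∑ v ∈ g.vars, pderiv v g * X (v.1, v.2 + 1)

/-- The `p`-th total derivative `g^{(p)}`. -/
def iterDeriv (δ : Derivation ℤ K K) (p : ℕ) (g : DiffPoly K n) : DiffPoly K n :=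
  (totalDeriv δ)^[p] g

/-- The maximal derivation order of the variable `X_j` in `g` (`0` if `X_j` does not occur). -/
def varOrder (g : DiffPoly K n) (j : Fin n) : ℕ :=
  (g.vars.filter fun v => v.1 = j).sup Prod.snd

/-- The maximal derivation order `e = max ε_{ij}` that occurs in the system. -/
def maxOrder (F : Fin r → DiffPoly K n) : ℕ :=
  Finset.univ.sup fun i => Finset.univ.sup fun j => varOrder (F i) j

/-- The polynomial ring `A_m = K[X^{[m]}]` of differential polynomials of order at most `m`. -/
abbrev A (K : Type*) [Field K] (n m : ℕ) : Subalgebra K (DiffPoly K n) :=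
  supported K {v : Fin n × ℕ | v.2 ≤ m}

theorem A_mono {m m' : ℕ} (h : m ≤ m') : A K n m ≤ A K n m' :=
  supported_mono fun _ hv => le_trans hv h

theorem pderiv_mem_A {m : ℕ} {g : DiffPoly K n} (hg : g ∈ A K n m) (v : Fin n × ℕ) :
    pderiv v g ∈ A K n m := by
  refine Algebra.adjoin_induction (p := fun g _ => pderiv v g ∈ A K n m) ?_ ?_ ?_ ?_ hg
  · rintro _ ⟨w, -, rfl⟩
    by_cases h : w = v
    · subst h
      rw [pderiv_X_self]
      exact one_mem _
    · rw [pderiv_X_of_ne h]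
      exact zero_mem _
  · intro c
    rw [Derivation.map_algebraMap]
    exact zero_mem _
  · intro a b _ _ ha hb
    rw [map_add]
    exact add_mem ha hb
  · intro a b ha' hb' ha hb
    rw [Derivation.leibniz, smul_eq_mul, smul_eq_mul]
    exact add_mem (mul_mem ha' hb) (mul_mem hb' ha)

theorem totalDeriv_mem_A (δ : Derivation ℤ K K) {m : ℕ} {g : DiffPoly K n}
    (hg : g ∈ A K n m) : totalDeriv δ g ∈ A K n (m + 1) := by
  have hv : ∀ v ∈ g.vars, v.2 ≤ m := fun v h => mem_supported.1 hg h
  refine add_mem (sum_mem fun s hs => ?_) (sum_mem fun v h => ?_)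
  · rw [mem_supported]
    intro w hw
    by_cases hc : δ (coeff s g) = 0
    · simp [hc] at hw
    · rw [vars_monomial hc] at hw
      exact (hv w ((mem_vars_iff_mem_support w).2 ⟨s, hs, hw⟩)).trans (Nat.le_succ m)
  · refine mul_mem (A_mono (Nat.le_succ m) (pderiv_mem_A hg v)) ?_
    exact X_mem_supported.2 (Nat.succ_le_succ (hv v h))

theorem mem_A_maxOrder (F : Fin r → DiffPoly K n) (j : Fin r) : F j ∈ A K n (maxOrder F) := by
  rw [mem_supported]
  intro v hv
  have h1 : v.2 ≤ varOrder (F j) v.1 :=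
    Finset.le_sup (f := Prod.snd) (Finset.mem_filter.2 ⟨hv, rfl⟩)
  have h2 : varOrder (F j) v.1 ≤ Finset.univ.sup fun l => varOrder (F j) l :=
    Finset.le_sup (f := fun l => varOrder (F j) l) (Finset.mem_univ _)
  have h3 : (Finset.univ.sup fun l => varOrder (F j) l) ≤ maxOrder F :=
    Finset.le_sup (f := fun i => Finset.univ.sup fun l => varOrder (F i) l) (Finset.mem_univ _)
  exact h1.trans (h2.trans h3)

theorem iterDeriv_mem_A (δ : Derivation ℤ K K) (F : Fin r → DiffPoly K n) (j : Fin r)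
    {p m : ℕ} (h : maxOrder F + p ≤ m) : iterDeriv δ p (F j) ∈ A K n m := by
  refine A_mono h ?_
  clear h
  induction p with
  | zero => exact mem_A_maxOrder F j
  | succ p ih =>
    rw [iterDeriv, Function.iterate_succ_apply']
    exact totalDeriv_mem_A δ ih

/-- `P` is stable under the total derivative. -/
def IsDifferentialIdeal (δ : Derivation ℤ K K) (P : Ideal (DiffPoly K n)) : Prop :=
  ∀ g ∈ P, totalDeriv δ g ∈ P

/-- `P` is minimal among the prime differential ideals that contain `F`. -/
def IsMinimalPrimeDifferential (δ : Derivation ℤ K K) (F : Fin r → DiffPoly K n)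
    (P : Ideal (DiffPoly K n)) : Prop :=
  Minimal (fun Q : Ideal (DiffPoly K n) =>
    Q.IsPrime ∧ IsDifferentialIdeal δ Q ∧ ∀ j, F j ∈ Q) P

/-- The prime ideal `A_m ∩ P` of `A_m`. -/
abbrev contr (P : Ideal (DiffPoly K n)) (m : ℕ) : Ideal (A K n m) :=
  P.comap (A K n m).val

/-- The Jacobian matrix of `F^{[i-1]}` (all `f_j^{(p)}` with `p < i`) with respect to the variables
`X^{[i-1+e]}`, as a matrix over `A_{i-1+e}`. -/
def fullJacobian (δ : Derivation ℤ K K) (F : Fin r → DiffPoly K n) (i : ℕ) :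
    Matrix (Fin i × Fin r) (Fin (i + maxOrder F) × Fin n) (A K n (i - 1 + maxOrder F)) :=
  fun a b => ⟨pderiv (b.2, (b.1 : ℕ)) (iterDeriv δ a.1 (F a.2)),
    pderiv_mem_A (iterDeriv_mem_A δ F a.2 (by have := a.1.2; omega)) _⟩

/-- The system is quasi-regular at `P`: for every `i ≥ 1` the Jacobian matrix of `F^{[i-1]}` has
full row rank over the domain `A_{i-1+e} / (A_{i-1+e} ∩ P)`. -/
def IsQuasiRegular (δ : Derivation ℤ K K) (F : Fin r → DiffPoly K n)
    (P : Ideal (DiffPoly K n)) : Prop :=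
  ∀ i : ℕ, 1 ≤ i →
    ((fullJacobian δ F i).map (Ideal.Quotient.mk (contr P (i - 1 + maxOrder F)))).rank = i * r

instance contr_isPrime (P : Ideal (DiffPoly K n)) [P.IsPrime] (m : ℕ) : (contr P m).IsPrime :=
  Ideal.comap_isPrime _ P

/-- The local ring `B_m`, the localization of `A_m` at the prime ideal `A_m ∩ P`. -/
def B (P : Ideal (DiffPoly K n)) [P.IsPrime] (m : ℕ) : Type _ :=
  Localization.AtPrime (contr P m)

instance (P : Ideal (DiffPoly K n)) [P.IsPrime] (m : ℕ) : CommRing (B P m) :=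
  inferInstanceAs (CommRing (Localization.AtPrime (contr P m)))

instance (P : Ideal (DiffPoly K n)) [P.IsPrime] (m : ℕ) : Algebra (A K n m) (B P m) :=
  inferInstanceAs (Algebra (A K n m) (Localization.AtPrime (contr P m)))

instance (P : Ideal (DiffPoly K n)) [P.IsPrime] (m : ℕ) :
    IsLocalization.AtPrime (B P m) (contr P m) :=
  inferInstanceAs (IsLocalization.AtPrime (Localization.AtPrime (contr P m)) (contr P m))

instance (P : Ideal (DiffPoly K n)) [P.IsPrime] (m : ℕ) : Algebra K (B P m) :=
  ((algebraMap (A K n m) (B P m)).comp (algebraMap K (A K n m))).toAlgebra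

instance (P : Ideal (DiffPoly K n)) [P.IsPrime] (m : ℕ) : IsScalarTower K (A K n m) (B P m) :=
  IsScalarTower.of_algebraMap_eq' rfl

/-- The inclusion `A_m ⊆ A_{m'}` for `m ≤ m'`. -/
def inclA (K : Type*) [Field K] (n : ℕ) {m m' : ℕ} (h : m ≤ m') : A K n m →+* A K n m' :=
  (Subalgebra.inclusion (A_mono (K := K) (n := n) h)).toRingHom

theorem coe_inclA {m m' : ℕ} (h : m ≤ m') (x : A K n m) :
    (inclA K n h x : DiffPoly K n) = x :=
  Subalgebra.coe_inclusion (A_mono h) x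

theorem mem_contr (P : Ideal (DiffPoly K n)) {m : ℕ} (x : A K n m) :
    x ∈ contr P m ↔ (x : DiffPoly K n) ∈ P := Iff.rfl

theorem primeCompl_le_comap_inclA (P : Ideal (DiffPoly K n)) [P.IsPrime] {m m' : ℕ} (h : m ≤ m') :
    (contr P m).primeCompl ≤ (contr P m').primeCompl.comap (inclA K n h) := by
  intro x hx
  rw [Submonoid.mem_comap, Ideal.mem_primeCompl_iff, mem_contr, coe_inclA]
  rwa [Ideal.mem_primeCompl_iff, mem_contr] at hx

/-- The inclusion `B_m → B_{m'}` for `m ≤ m'`, induced by `A_m ⊆ A_{m'}`. -/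
def inclB (P : Ideal (DiffPoly K n)) [P.IsPrime] {m m' : ℕ} (h : m ≤ m') : B P m →+* B P m' :=
  IsLocalization.map (B P m') (inclA K n h) (primeCompl_le_comap_inclA P h)

/-- The ideal `Δ_q` generated in `B_m` by the total derivatives of order `< q` of the equations.
By `iterDeriv_mem_A` they all lie in `A_m` as soon as `q - 1 + e ≤ m`. -/
def Delta (δ : Derivation ℤ K K) (F : Fin r → DiffPoly K n)
    (P : Ideal (DiffPoly K n)) [P.IsPrime] (q m : ℕ) : Ideal (B P m) :=
  Ideal.span {b | ∃ (p : ℕ) (j : Fin r) (h : iterDeriv δ p (F j) ∈ A K n m),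
    p < q ∧ b = algebraMap (A K n m) (B P m) ⟨iterDeriv δ p (F j), h⟩}

/-- The pseudo-Jacobian matrix `𝔍_{k,i}` (for `i ≥ e - 1`), with `r × n` blocks
`∂F^{(i-e+1+a)} / ∂X^{(i+1+b)}`, `0 ≤ a, b < k`. The blocks with `b > a` vanish because
`F^{(i-e+1+a)}` has order at most `i+1+a`. -/
def pseudoJacobian (δ : Derivation ℤ K K) (F : Fin r → DiffPoly K n) (k i : ℕ) :
    Matrix (Fin k × Fin r) (Fin k × Fin n) (DiffPoly K n) :=
  fun a b => pderiv (b.2, i + 1 + (b.1 : ℕ)) (iterDeriv δ (i + 1 - maxOrder F + a.1) (F a.2))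

theorem pseudoJacobian_mem_A (δ : Derivation ℤ K K) (F : Fin r → DiffPoly K n) {k i m : ℕ}
    (hi : maxOrder F ≤ i + 1) (hm : i + k ≤ m) (a : Fin k × Fin r) (b : Fin k × Fin n) :
    pseudoJacobian δ F k i a b ∈ A K n m :=
  pderiv_mem_A (iterDeriv_mem_A δ F a.2 (by have := a.1.2; omega)) _

/-- The rank of `𝔍_{k,i}` over the domain `B_{i+k+s} / Δ_{i-e+1+k+s}`. -/
def rankMod (δ : Derivation ℤ K K) (F : Fin r → DiffPoly K n)
    (P : Ideal (DiffPoly K n)) [P.IsPrime] (k i s : ℕ) (hi : maxOrder F ≤ i + 1) : ℕ :=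
  Matrix.rank (R := B P (i + k + s) ⧸ Delta δ F P (i + 1 - maxOrder F + k + s) (i + k + s))
    fun (a : Fin k × Fin r) (b : Fin k × Fin n) =>
      Ideal.Quotient.mk _ (algebraMap (A K n (i + k + s)) (B P (i + k + s))
        ⟨pseudoJacobian δ F k i a b, pseudoJacobian_mem_A δ F hi (Nat.le_add_right _ s) a b⟩)

/-- The constant rank hypothesis: the rank of `𝔍_{k,i}` over `B_{i+k+s} / Δ_{i-e+1+k+s}` does not
depend on `s`. -/
def HasConstantRanks (δ : Derivation ℤ K K) (F : Fin r → DiffPoly K n)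
    (P : Ideal (DiffPoly K n)) [P.IsPrime] : Prop :=
  ∀ (k i : ℕ) (hi : maxOrder F ≤ i + 1) (s s' : ℕ),
    rankMod δ F P k i s hi = rankMod δ F P k i s' hi

/-- `μ_{k,i}`, the dimension of the kernel of the transpose of `𝔍_{k,i}` over the residue field of
`P`, and `0` for `k = 0`. -/
def mu (δ : Derivation ℤ K K) (F : Fin r → DiffPoly K n)
    (P : Ideal (DiffPoly K n)) [P.IsPrime] (k i : ℕ) : ℕ :=
  if k = 0 then 0 else
    Module.finrank P.ResidueField (LinearMap.ker
      (((pseudoJacobian δ F k i).map (algebraMap (DiffPoly K n) P.ResidueField)).transpose).mulVecLin)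

/-- The transcendence degree of the extension `Frac(R / (I ∩ R)) ⊆ Frac(S / I)` induced by a ring
homomorphism `φ : R → S` and a prime ideal `I` of `S`, where `I ∩ R` is the preimage of `I`. -/
def trdegFrac {R S : Type*} [CommRing R] [CommRing S] (φ : R →+* S) (I : Ideal S) [I.IsPrime] :
    Cardinal :=
  letI : Algebra (FractionRing (R ⧸ I.comap φ)) (FractionRing (S ⧸ I)) :=
    (IsFractionRing.map (Ideal.quotientMap_injective (I := I) (f := φ))).toAlgebra
  Algebra.trdeg (FractionRing (R ⧸ I.comap φ)) (FractionRing (S ⧸ I))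

end DAE

end

/-! Primality comes from regularity. The ring `B_m` is a regular local ring, and quasi-regularity
says that the differentials of the generators of `Δ_q` are linearly independent at `P`. These
generators are therefore independent in the cotangent space, so `B_m / Δ_q` is again regular local,
hence a domain (`Delta_isPrime`).

In characteristic zero the transcendence degree of a field extension is the dimension of its space
of derivations. For a fraction field presented by polynomial relations, over a subfield generated by
constants and some of the variables, that space is the kernel of the Jacobian matrix in the
remaining variables (`trdeg_eq_finrank_ker_jacobian`). Over `K` the Jacobian has full row rank, so
`Frac(B_m / Δ_q)` has degree `(m+1)n - qr`. Over `Frac(B_i / (Δ ∩ B_i))` only the rows of `𝔍_{k,i}`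
matter, and the degree is `kn - rank 𝔍_{k,i}`.

The number `μ_{k,i}` measures the rank over the residue field of `P` instead. Minimality makes `P`
equal to the saturation of the differential ideal generated by `F`, so finitely many elements of `P`
all lie in `Δ_q` for large `q`. Hence the rank over the residue field is the rank modulo `Δ` for
large `s`, and by constancy also for `s = 0` (`rank_residueField_eq_rankMod`). This gives (i), and
(ii) follows by additivity of transcendence degrees in the tower. -/

/-! ### Regular local rings: quotients by part of a regular system of parameters, and integrality.
-/

section RegularLocal

open IsLocalRing

variable {R : Type*} [CommRing R]

/-- Dividing a Noetherian local ring by elements whose classes in the cotangent space are linearly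
independent lowers the embedding dimension by the number of these elements. -/
theorem spanFinrank_maximalIdeal_quotient_add_card_le [IsLocalRing R] [IsNoetherianRing R]
    {ι : Type*} [Fintype ι] (f : ι → maximalIdeal R)
    (hf : LinearIndependent (ResidueField R) fun i => (maximalIdeal R).toCotangent (f i))
    {I : Ideal R} (hI : I = Ideal.span (Set.range fun i => (f i : R))) [IsLocalRing (R ⧸ I)] :
    (maximalIdeal (R ⧸ I)).spanFinrank + Fintype.card ι ≤ (maximalIdeal R).spanFinrank := by
  classical
  let b := Module.Basis.sumExtend hf
  have : Finite (ι ⊕ Module.Basis.sumExtendIndex hf) := Module.Finite.finite_basis b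
  have : Finite (Module.Basis.sumExtendIndex hf) := Finite.sum_right ι
  have := Fintype.ofFinite (Module.Basis.sumExtendIndex hf)
  choose g hg using fun k => (maximalIdeal R).toCotangent_surjective (b (Sum.inr k))
  -- The classes are completed to a basis of the cotangent space; by Nakayama the lifts generate the
  -- maximal ideal, and modulo `I` only the added lifts `g` survive.
  have hspan : Submodule.span R (Set.range f ∪ Set.range g) = ⊤ := by
    rw [← CotangentSpace.span_image_eq_top_iff, eq_top_iff, ← b.span_eq]
    refine Submodule.span_mono ?_
    rintro _ ⟨i | k, rfl⟩
    · exact ⟨f i, Or.inl ⟨i, rfl⟩, by simp [b, Module.Basis.sumExtend]; rfl⟩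
    · exact ⟨g k, Or.inr ⟨k, rfl⟩, hg k⟩
  have hmax : maximalIdeal R = Ideal.span
      ((Set.range fun i => (f i : R)) ∪ Set.range fun k => (g k : R)) := by
    have := congrArg (Submodule.map (maximalIdeal R).subtype) hspan
    rw [Submodule.map_span, Submodule.map_top, Submodule.range_subtype, Set.image_union,
      ← Set.range_comp, ← Set.range_comp] at this
    exact this.symm
  have hquot : maximalIdeal (R ⧸ I) =
      Ideal.span (Set.range fun k => Ideal.Quotient.mk I (g k : R)) := by
    have h1 := map_maximalIdeal_of_surjective (Ideal.Quotient.mk I) Ideal.Quotient.mk_surjective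
    have h2 := congrArg (Ideal.map (Ideal.Quotient.mk I)) hmax
    rw [← h1, h2, Ideal.map_span, Set.image_union, ← Set.range_comp, ← Set.range_comp,
      Ideal.span_union, sup_eq_right.2]
    · rfl
    · rw [Ideal.span_le]
      rintro _ ⟨i, rfl⟩
      have : (f i : R) ∈ I := hI ▸ Ideal.subset_span ⟨i, rfl⟩
      simp [Ideal.Quotient.eq_zero_iff_mem.2 this]
  have hle : (maximalIdeal (R ⧸ I)).spanFinrank ≤
      Fintype.card (Module.Basis.sumExtendIndex hf) := by
    rw [hquot]
    refine (Submodule.spanFinrank_span_le_ncard_of_finite (Set.finite_range _)).trans ?_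
    rw [← Nat.card_eq_fintype_card, ← Nat.card_coe_set_eq]
    exact Finite.card_range_le _
  have hcard : Module.finrank (ResidueField R) (CotangentSpace R) = _ :=
    Module.finrank_eq_card_basis b
  have hrank := spanFinrank_maximalIdeal_eq_finrank_cotangentSpace R
  rw [Fintype.card_sum] at hcard
  omega

/-- The embedding dimension drops by at least the number of elements, while the Krull dimension
drops by at most that number, since `I` has that many generators. So the embedding dimension of the
quotient is still at most its Krull dimension. -/
theorem IsRegularLocalRing.quotient_span [IsRegularLocalRing R]
    {ι : Type*} [Fintype ι] (f : ι → maximalIdeal R)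
    (hf : LinearIndependent (ResidueField R) fun i => (maximalIdeal R).toCotangent (f i))
    {I : Ideal R} (hI : I = Ideal.span (Set.range fun i => (f i : R))) :
    IsRegularLocalRing (R ⧸ I) := by
  have hIm : I ≤ maximalIdeal R := by
    rw [hI, Ideal.span_le]
    rintro _ ⟨i, rfl⟩
    exact (f i).2
  have hItop : I ≠ ⊤ := fun h => (maximalIdeal.isMaximal R).ne_top (top_le_iff.1 (h ▸ hIm))
  have : Nontrivial (R ⧸ I) := Ideal.Quotient.nontrivial_iff.2 hItop
  have : IsLocalRing (R ⧸ I) :=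
    IsLocalRing.of_surjective' (Ideal.Quotient.mk I) Ideal.Quotient.mk_surjective
  refine .of_spanFinrank_maximalIdeal_le _ ?_
  have h1 := spanFinrank_maximalIdeal_quotient_add_card_le f hf hI
  have h2 := ringKrullDim_le_ringKrullDim_quotient_add_spanFinrank I
    (by rwa [IsLocalRing.ringJacobson_eq_maximalIdeal])
  rw [← IsRegularLocalRing.spanFinrank_maximalIdeal] at h2
  have h3 : I.spanFinrank ≤ Fintype.card ι := by
    rw [hI]
    refine (Submodule.spanFinrank_span_le_ncard_of_finite (Set.finite_range _)).trans ?_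
    rw [← Nat.card_eq_fintype_card, ← Nat.card_coe_set_eq]
    exact Finite.card_range_le _
  generalize ringKrullDim (R ⧸ I) = d at *
  induction d with
  | bot => simp at h2
  | coe d =>
    induction d with
    | top => exact le_top
    | coe d =>
      norm_cast at h2 ⊢
      omega

theorem linearIndependent_toCotangent_of_notMem_sq [IsLocalRing R] (x : maximalIdeal R)
    (hx : (x : R) ∉ maximalIdeal R ^ 2) :
    LinearIndependent (ResidueField R) fun _ : Unit => (maximalIdeal R).toCotangent x := by
  have h0 : (maximalIdeal R).toCotangent x ≠ 0 :=
    fun h0 => hx (((maximalIdeal R).toCotangent_eq_zero _).1 h0)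
  exact LinearIndependent.of_subsingleton (R := ResidueField R) (M := CotangentSpace R) () h0

/-- Induction on the embedding dimension. For `x` in the maximal ideal, outside its square and
outside every minimal prime, `R/(x)` is regular of smaller embedding dimension, so `(x)` is prime. A
minimal prime `q ≤ (x)` does not contain `x`, so `q = xq`, and Nakayama gives `q = 0`. -/
theorem isDomain_of_spanFinrank_maximalIdeal_le (d : ℕ) : ∀ {R : Type*} [CommRing R]
    [IsRegularLocalRing R], (maximalIdeal R).spanFinrank ≤ d → IsDomain R := by
  induction d with
  | zero =>
    intro R _ _ h
    have h0 : maximalIdeal R = ⊥ :=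
      (Submodule.spanFinrank_eq_zero_iff_eq_bot (IsNoetherian.noetherian _)).1 (Nat.le_zero.1 h)
    exact (IsLocalRing.isField_iff_maximalIdeal_eq.2 h0).isDomain
  | succ d ih =>
    intro R _ _ h
    by_cases hfield : IsField R
    · exact hfield.isDomain
    have hsq : ¬ maximalIdeal R ≤ maximalIdeal R ^ 2 := by
      intro hle
      apply hfield
      rw [IsLocalRing.isField_iff_maximalIdeal_eq]
      refine Submodule.eq_bot_of_le_smul_of_le_jacobson_bot (maximalIdeal R) _
        (IsNoetherian.noetherian _) ?_ (IsLocalRing.jacobson_eq_maximalIdeal _ bot_ne_top).ge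
      rwa [smul_eq_mul, ← pow_two]
    -- Otherwise the maximal ideal has height zero, and a regular local ring of dimension zero is a
    -- field.
    have hmin : ∀ q ∈ minimalPrimes R, ¬ maximalIdeal R ≤ q := by
      intro q hq hle
      have hqp : q.IsPrime := hq.1.1
      have hqm : maximalIdeal R = q := (maximalIdeal.isMaximal R).eq_of_le hqp.ne_top hle
      have h0 : (maximalIdeal R).height = 0 := Ideal.height_eq_zero_iff.2 (hqm ▸ hq)
      have h1 := IsLocalRing.maximalIdeal_height_eq_ringKrullDim (R := R)
      rw [h0, ← IsRegularLocalRing.spanFinrank_maximalIdeal] at h1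
      have h2 : (maximalIdeal R).spanFinrank = 0 := by exact_mod_cast h1.symm
      exact hfield (IsLocalRing.isField_iff_maximalIdeal_eq.2
        ((Submodule.spanFinrank_eq_zero_iff_eq_bot (IsNoetherian.noetherian _)).1 h2))
    have hfin := minimalPrimes.finite_of_isNoetherianRing R
    obtain ⟨x, hxm, hx⟩ : ∃ x ∈ maximalIdeal R,
        x ∉ maximalIdeal R ^ 2 ∧ ∀ q ∈ minimalPrimes R, x ∉ q := by
      classical
      by_contra! hcon
      have hsub : ((maximalIdeal R : Ideal R) : Set R) ⊆
          ⋃ q ∈ (↑(insert (maximalIdeal R ^ 2) hfin.toFinset) : Set (Ideal R)), (q : Set R) := by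
        intro x hx
        rw [Set.mem_iUnion₂]
        by_cases hx2 : x ∈ maximalIdeal R ^ 2
        · exact ⟨_, by simp, hx2⟩
        · obtain ⟨q, hq, hxq⟩ := hcon x hx hx2
          exact ⟨q, by simp [hq], hxq⟩
      -- Prime avoidance tolerates two ideals that need not be prime; the square of the maximal
      -- ideal fills both places.
      obtain ⟨q, hq, hle⟩ := (Ideal.subset_union_prime (f := id) (maximalIdeal R ^ 2)
        (maximalIdeal R ^ 2) (fun q hq hne _ => by
          have : q ∈ minimalPrimes R := by simpa [hne] using hq
          exact this.1.1)).1 hsub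
      rw [Finset.mem_insert] at hq
      rcases hq with rfl | hq
      · exact hsq hle
      · exact hmin q (by simpa using hq) hle
    let f : Unit → maximalIdeal R := fun _ => ⟨x, hxm⟩
    have hf : LinearIndependent (ResidueField R)
        fun i => (maximalIdeal R).toCotangent (f i) := by
      exact linearIndependent_toCotangent_of_notMem_sq _ hx.1
    have hI : Ideal.span {x} = Ideal.span (Set.range fun i => (f i : R)) := by
      simp [f]
    have hreg := IsRegularLocalRing.quotient_span f hf hI
    have hle := spanFinrank_maximalIdeal_quotient_add_card_le f hf hI
    have hdom : IsDomain (R ⧸ Ideal.span {x}) := ih (by simp at hle; omega)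
    have hprime : (Ideal.span {x}).IsPrime := (Ideal.Quotient.isDomain_iff_prime _).1 hdom
    obtain ⟨q, hq, hqle⟩ := Ideal.exists_minimalPrimes_le (bot_le : (⊥ : Ideal R) ≤ Ideal.span {x})
    have hqp : q.IsPrime := hq.1.1
    have hq0 : q = ⊥ := by
      refine Submodule.eq_bot_of_le_smul_of_le_jacobson_bot (maximalIdeal R) _
        (IsNoetherian.noetherian _) ?_ (IsLocalRing.jacobson_eq_maximalIdeal _ bot_ne_top).ge
      intro y hy
      obtain ⟨z, rfl⟩ := Ideal.mem_span_singleton.1 (hqle hy)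
      exact Submodule.smul_mem_smul hxm ((hqp.mem_or_mem hy).resolve_left (hx.2 q hq))
    rw [hq0] at hqp
    exact IsDomain.of_bot_isPrime R

/-- A regular local ring is a domain. -/
theorem IsRegularLocalRing.isDomain [IsRegularLocalRing R] : IsDomain R :=
  isDomain_of_spanFinrank_maximalIdeal_le _ le_rfl

/-- A criterion for the linear independence of elements of a prime ideal in the cotangent space of
the localization. -/
theorem linearIndependent_toCotangent_of_isLocalization {A S ι : Type*} [CommRing A] [CommRing S]
    [Algebra A S] [IsLocalRing S] [Fintype ι] (p : Ideal A) [p.IsPrime]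
    [IsLocalization.AtPrime S p] (f : ι → A) (hf : ∀ a, algebraMap A S (f a) ∈ maximalIdeal S)
    (h : ∀ (c : ι → A) (t : A), t ∉ p → t * ∑ a, c a * f a ∈ p ^ 2 → ∀ a, c a ∈ p) :
    LinearIndependent (ResidueField S)
      fun a => (maximalIdeal S).toCotangent ⟨algebraMap A S (f a), hf a⟩ := by
  have hmax : p.map (algebraMap A S) = maximalIdeal S :=
    IsLocalization.AtPrime.map_eq_maximalIdeal p S
  rw [Fintype.linearIndependent_iff]
  intro g hg
  choose b hb using fun a => IsLocalRing.residue_surjective (g a)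
  -- A common denominator `s` moves the relation to coefficients `c` in `A`, where `h` applies.
  obtain ⟨s, hs⟩ := IsLocalization.exist_integer_multiples_of_finite p.primeCompl b
  choose c hc using hs
  have hsum : algebraMap A S (∑ a, c a * f a) ∈ maximalIdeal S ^ 2 := by
    have h1 : (maximalIdeal S).toCotangent
        (∑ a, algebraMap A S (c a) • ⟨algebraMap A S (f a), hf a⟩) = 0 := by
      rw [map_sum, ← smul_zero (algebraMap A S s), ← hg, Finset.smul_sum]
      refine Finset.sum_congr rfl fun a _ => ?_
      rw [map_smul, hc, Algebra.smul_def, mul_smul, ← hb a]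
      rfl
    rw [Ideal.toCotangent_eq_zero] at h1
    convert h1 using 1
    simp [Algebra.smul_def]
  rw [← hmax, ← Ideal.map_pow,
    IsLocalization.algebraMap_mem_map_algebraMap_iff p.primeCompl] at hsum
  obtain ⟨t, ht, hts⟩ := hsum
  intro a
  have hca : algebraMap A S (c a) ∈ maximalIdeal S :=
    hmax ▸ Ideal.mem_map_of_mem _ (h c t ht hts a)
  rw [hc, Algebra.smul_def, ← IsLocalRing.residue_eq_zero_iff, map_mul, hb] at hca
  refine (mul_eq_zero.1 hca).resolve_left ?_
  rw [IsLocalRing.residue_eq_zero_iff, IsLocalRing.mem_maximalIdeal, mem_nonunits_iff, not_not]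
  exact IsLocalization.map_units S s

end RegularLocal

/-! ### Matrix rank through minors, and its invariance under passage to a larger field. -/

section MatrixRank

namespace Matrix

variable {m n : Type*} [Fintype m] [Fintype n]

theorem exists_linearIndependent_comp_of_le_finrank_span {E V ι : Type*} [Field E]
    [AddCommGroup V] [Module E V] [Finite ι] (w : ι → V) {t : ℕ}
    (ht : t ≤ Module.finrank E (Submodule.span E (Set.range w))) :
    ∃ u : Fin t → ι, LinearIndependent E (w ∘ u) := by
  have := FiniteDimensional.span_of_finite E (Set.finite_range w)
  obtain ⟨f, hf, -, hli⟩ := Submodule.exists_fun_fin_finrank_span_eq E (Set.range w)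
  choose u hu using hf
  refine ⟨u ∘ Fin.castLE ht, ?_⟩
  have : w ∘ u ∘ Fin.castLE ht = f ∘ Fin.castLE ht := funext fun i => hu _
  rw [this]
  exact hli.comp _ (Fin.castLE_injective ht)

/-- The rank of a matrix over a field is at least `t` if and only if some minor of size `t` does
not vanish. -/
theorem le_rank_iff_exists_det_submatrix_ne_zero {E : Type*} [Field E] (A : Matrix m n E) (t : ℕ) :
    t ≤ A.rank ↔ ∃ (u : Fin t → m) (v : Fin t → n), (A.submatrix u v).det ≠ 0 := by
  constructor
  · intro h
    rw [rank_eq_finrank_span_row] at h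
    obtain ⟨u, hu⟩ := exists_linearIndependent_comp_of_le_finrank_span _ h
    have h2 : (A.submatrix u id).rank = t := by
      have := LinearIndependent.rank_matrix (M := A.submatrix u id) hu
      simpa using this
    rw [rank_eq_finrank_span_cols] at h2
    obtain ⟨v, hv⟩ := exists_linearIndependent_comp_of_le_finrank_span _ h2.ge
    refine ⟨u, v, ?_⟩
    have h3 : LinearIndependent E (A.submatrix u v).col := hv
    rw [linearIndependent_cols_iff_isUnit] at h3
    exact ((isUnit_iff_isUnit_det _).1 h3).ne_zero
  · rintro ⟨u, v, h⟩
    have := rank_of_det_ne_zero h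
    have h2 := A.rank_submatrix_le u v
    simpa [this] using h2

/-- The column span over `Q` is the localization of the column span over `R`, and localizing at the
nonzero divisors preserves `finrank`. -/
theorem rank_map_algebraMap_fractionRing {R Q : Type*} [CommRing R] [IsDomain R] [Field Q]
    [Algebra R Q] [IsFractionRing R Q] (A : Matrix m n R) :
    (A.map (algebraMap R Q)).rank = A.rank := by
  let f : (m → R) →ₗ[R] (m → Q) := (Algebra.linearMap R Q).compLeft m
  have hf : IsLocalizedModule (nonZeroDivisors R) f :=
    inferInstanceAs (IsLocalizedModule _ (LinearMap.pi fun i : m =>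
      (Algebra.linearMap R Q).comp (LinearMap.proj i)))
  have hspan : Submodule.span Q (Set.range (A.map (algebraMap R Q)).col) =
      (Submodule.span R (Set.range A.col)).localized' Q (nonZeroDivisors R) f := by
    rw [Submodule.localized'_span, ← Set.range_comp]
    rfl
  rw [rank_eq_finrank_span_cols, rank_eq_finrank_span_cols, hspan,
    IsLocalization.finrank_eq Q (nonZeroDivisors R) le_rfl,
    IsLocalizedModule.finrank_eq (nonZeroDivisors R)
      (Submodule.toLocalized' Q (nonZeroDivisors R) f (Submodule.span R (Set.range A.col))) le_rfl]

/-- The rank of a matrix over a domain can be computed over any field containing the domain. -/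
theorem rank_map_of_injective {R E : Type*} [CommRing R] [IsDomain R] [Field E] (φ : R →+* E)
    (hφ : Function.Injective φ) (A : Matrix m n R) : (A.map φ).rank = A.rank := by
  have key : ∀ {Q E : Type _} [Field Q] [Field E] (ψ : Q →+* E) (B : Matrix m n Q),
      (B.map ψ).rank = B.rank := by
    intro Q E _ _ ψ B
    refine eq_of_forall_le_iff fun t => ?_
    rw [le_rank_iff_exists_det_submatrix_ne_zero, le_rank_iff_exists_det_submatrix_ne_zero]
    refine exists_congr fun u => exists_congr fun v => ?_
    rw [submatrix_map, ← RingHom.mapMatrix_apply, ← RingHom.map_det, Ne, map_eq_zero]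
  rw [← rank_map_algebraMap_fractionRing (Q := FractionRing R) A,
    ← key (IsFractionRing.lift hφ : FractionRing R →+* E), Matrix.map_map]
  congr 1
  ext a b
  simp

end Matrix

end MatrixRank

/-! ### Transcendence degree, derivations and Jacobian matrices in characteristic zero. -/

section TranscendenceDegree

universe u

open scoped TensorProduct

/-- In characteristic zero, the transcendence degree is the dimension of the Kähler differentials. -/
theorem trdeg_eq_rank_kaehlerDifferential (M E : Type*) [Field M] [Field E] [Algebra M E]
    [CharZero M] : Algebra.trdeg M E = Module.rank E (Ω[E⁄M]) := by
  obtain ⟨s, hs⟩ := exists_isTranscendenceBasis M E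
  let _ : Algebra (MvPolynomial s M) E := (aeval ((↑) : s → E)).toAlgebra
  have : IsScalarTower M (MvPolynomial s M) E := IsScalarTower.of_algHom (aeval ((↑) : s → E))
  have hinj : Function.Injective (algebraMap (MvPolynomial s M) E) := hs.1
  have : FaithfulSMul (MvPolynomial s M) E :=
    (faithfulSMul_iff_algebraMap_injective _ _).2 hinj
  let _ := FractionRing.liftAlgebra (MvPolynomial s M) E
  have : Algebra.IsAlgebraic (MvPolynomial s M) E := by
    have := hs.isAlgebraic
    refine Algebra.IsAlgebraic.of_ringHom_of_comp_eq hs.1.aevalEquiv (RingHom.id E)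
      hs.1.aevalEquiv.surjective Function.injective_id ?_
    ext x <;> simp [RingHom.algebraMap_toAlgebra]
  have : Algebra.IsAlgebraic (FractionRing (MvPolynomial s M)) E :=
    IsFractionRing.comap_isAlgebraic_iff (A := MvPolynomial s M).1 this
  -- `E` is algebraic, hence separable, over `M(s)`, and `M(s)` is a localization of `M[s]`.
  -- Therefore `Ω[E⁄M]` is the base change of `Ω[M[s]⁄M]`, with basis indexed by `s`.
  have : Algebra.FormallyEtale (MvPolynomial s M) E := by
    have h1 : Algebra.FormallyEtale (MvPolynomial s M) (FractionRing (MvPolynomial s M)) :=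
      .of_isLocalization (nonZeroDivisors _)
    have : CharZero (FractionRing (MvPolynomial s M)) := inferInstance
    have h2 : Algebra.FormallyEtale (FractionRing (MvPolynomial s M)) E := .of_isSeparable _ E
    exact .comp _ (FractionRing (MvPolynomial s M)) _
  rw [← hs.cardinalMk_eq_trdeg]
  let b := ((KaehlerDifferential.mvPolynomialBasis M s).baseChange E).map
    (KaehlerDifferential.tensorKaehlerEquivOfFormallyEtale M (MvPolynomial s M) E)
  exact b.mk_eq_rank''

theorem trdeg_eq_finrank_derivation (M E : Type*) [Field M] [Field E] [Algebra M E]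
    [CharZero M] [FiniteDimensional E (Derivation M E E)] :
    Algebra.trdeg M E = Module.finrank E (Derivation M E E) := by
  let e := KaehlerDifferential.linearMapEquivDerivation M E (M := E)
  have : FiniteDimensional E (Module.Dual E (Ω[E⁄M])) :=
    Module.Finite.equiv (KaehlerDifferential.linearMapEquivDerivation M E (M := E)).symm
  have : FiniteDimensional E (Ω[E⁄M]) := Module.finite_dual_iff E |>.1 this
  rw [trdeg_eq_rank_kaehlerDifferential, ← Module.finrank_eq_rank, ← e.finrank_eq,
   ← Subspace.dual_finrank_eq (V := Ω[E⁄M])]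

/-- A derivation along a ring homomorphism `σ` to a field extends to that field if it kills the
kernel of `σ` and the field consists of fractions of elements of the image. -/
theorem exists_derivation_extending {A E : Type*} [CommRing A] [Field E] (σ : A →+* E)
    (hσ : ∀ x, ∃ a b, σ b ≠ 0 ∧ x * σ b = σ a) (d : A →+ E)
    (hd : ∀ a b, d (a * b) = σ a * d b + σ b * d a) (hker : ∀ a, σ a = 0 → d a = 0) :
    ∃ D : Derivation ℤ E E, ∀ a, D (σ a) = d a := by
  choose num den hden hfrac using hσ
  -- The quotient rule, forced by differentiating `x * σ (den x) = σ (num x)`.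
  let D : E → E := fun x => (d (num x) - x * d (den x)) / σ (den x)
  -- The value of `D` does not depend on the chosen fraction; additivity and the Leibniz rule then
  -- follow by choosing convenient fractions. The hypothesis on the kernel enters here.
  have key : ∀ x a b, x * σ b = σ a → d a = x * d b + σ b * D x := by
    intro x a b hab
    have h0 : d (a * den x - num x * b) = 0 := by
      apply hker
      rw [map_sub, map_mul, map_mul, ← hab, ← hfrac x]
      ring
    rw [map_sub, hd, hd, ← hab, ← hfrac x] at h0
    have hD : D x * σ (den x) = d (num x) - x * d (den x) := div_mul_cancel₀ _ (hden x)
    refine mul_left_cancel₀ (hden x) ?_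
    linear_combination h0 - σ b * hD
  have d1 : d 1 = 0 := by simpa using hd 1 1
  have hadd : ∀ x y, D (x + y) = D x + D y := by
    intro x y
    have hx := key x _ _ (hfrac x)
    have hy := key y _ _ (hfrac y)
    have hxy := key (x + y) (num x * den y + num y * den x) (den x * den y) (by
      simp only [map_add, map_mul, ← hfrac]; ring)
    simp only [map_add, hd, map_mul, ← hfrac] at hxy
    refine mul_left_cancel₀ (mul_ne_zero (hden x) (hden y)) ?_
    linear_combination σ (den y) * hx + σ (den x) * hy - hxy
  have hmul : ∀ x y, D (x * y) = x * D y + y * D x := by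
    intro x y
    have hx := key x _ _ (hfrac x)
    have hy := key y _ _ (hfrac y)
    have hxy := key (x * y) (num x * num y) (den x * den y) (by
      simp only [map_mul, ← hfrac]; ring)
    simp only [hd, map_mul, ← hfrac] at hxy
    refine mul_left_cancel₀ (mul_ne_zero (hden x) (hden y)) ?_
    linear_combination y * σ (den y) * hx + x * σ (den x) * hy - hxy
  refine ⟨Derivation.mk' (AddMonoidHom.mk' D hadd).toIntLinearMap hmul, fun a => ?_⟩
  have := key (σ a) a 1 (by simp)
  rw [d1, map_one, mul_zero, zero_add, one_mul] at this
  exact this.symm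

/-- Let `σ` map a polynomial ring onto a ring of which `E` is the field of fractions, such that its
kernel is defined generically by the polynomials `f a`, and let `M` correspond to the subfield of
`E` generated by the constants and the variables outside the range of `c`. Then the transcendence
degree of `E` over `M` is the dimension of the kernel of the Jacobian matrix of `f` with respect to
the variables `c b`. -/
theorem trdeg_eq_finrank_ker_jacobian {K M E V ι β : Type*} [Field K] [Field M] [CharZero M]
    [Field E] [Algebra M E] [Fintype β] (σ : MvPolynomial V K →+* E)
    (hσ : ∀ x, ∃ a b, σ b ≠ 0 ∧ x * σ b = σ a)
    (f : ι → MvPolynomial V K)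
    (hker : ∀ g, σ g = 0 → ∃ s, σ s ≠ 0 ∧ s * g ∈ Ideal.span (Set.range f))
    (hf : ∀ a, σ (f a) = 0)
    (c : β → V) (hc : Function.Injective c)
    (hM : ∀ x : M, algebraMap M E x ∈
      Subfield.closure (σ '' (Set.range C ∪ X '' (Set.range c)ᶜ)))
    (hMC : ∀ x, σ (C x) ∈ Set.range (algebraMap M E))
    (hMX : ∀ v ∉ Set.range c, σ (X v) ∈ Set.range (algebraMap M E)) :
    Algebra.trdeg M E = Module.finrank E (LinearMap.ker
      (Matrix.of fun (a : ι) (b : β) => σ (pderiv (c b) (f a))).mulVecLin) := by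
  classical
  -- The derivation along `σ` that kills the constants and the variables outside the range of `c`,
  -- and takes the value `w b` at `X (c b)`.
  let d : (β → E) → MvPolynomial V K →+ E := fun w => AddMonoidHom.mk'
    (fun g => ∑ b, σ (pderiv (c b) g) * w b) fun g h => by
      simp only [map_add, add_mul, Finset.sum_add_distrib]
  have hd : ∀ w g h, d w (g * h) = σ g * d w h + σ h * d w g := by
    intro w g h
    simp only [d, AddMonoidHom.mk'_apply, pderiv_mul, map_add, map_mul, Finset.mul_sum,
      ← Finset.sum_add_distrib]
    exact Finset.sum_congr rfl fun b _ => by ring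
  have hdX : ∀ w b, d w (X (c b)) = w b := by
    intro w b
    simp only [d, AddMonoidHom.mk'_apply]
    rw [Finset.sum_eq_single b]
    · simp
    · intro b' _ hb
      rw [pderiv_X_of_ne fun h => hb (hc h).symm, map_zero, zero_mul]
    · simp
  have hdX' : ∀ w, ∀ v ∉ Set.range c, d w (X v) = 0 := by
    intro w v hv
    refine Finset.sum_eq_zero fun b _ => ?_
    rw [pderiv_X_of_ne fun h => hv ⟨b, h.symm⟩, map_zero, zero_mul]
  have hdC : ∀ w x, d w (C x) = 0 := by
    intro w x
    simp [d]
  -- Every `M`-derivation of `E` pulls back along `σ` to some `d w`; conversely `d w` descends when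
  -- `w` is in the kernel of the Jacobian.
  have hD : ∀ (D : Derivation M E E) g, D (σ g) = d (fun b => D (σ (X (c b)))) g := by
    intro D g
    induction g using MvPolynomial.induction_on with
    | C x =>
      obtain ⟨y, hy⟩ := hMC x
      rw [hdC, ← hy, D.map_algebraMap]
    | add g h hg hh => rw [map_add, map_add, map_add, hg, hh]
    | mul_X g v hg =>
      rw [map_mul, D.leibniz, hd, hg, smul_eq_mul, smul_eq_mul]
      congr 2
      by_cases hv : v ∈ Set.range c
      · obtain ⟨b, rfl⟩ := hv
        rw [hdX]
      · obtain ⟨y, hy⟩ := hMX v hv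
        rw [hdX' _ v hv, ← hy, D.map_algebraMap]
  let J : Matrix ι β E := Matrix.of fun a b => σ (pderiv (c b) (f a))
  have hJ : ∀ w, w ∈ LinearMap.ker J.mulVecLin ↔ ∀ a, d w (f a) = 0 := by
    intro w
    rw [LinearMap.mem_ker, Matrix.mulVecLin_apply, funext_iff]
    rfl
  let Φ : Derivation M E E →ₗ[E] LinearMap.ker J.mulVecLin :=
    { toFun := fun D => ⟨fun b => D (σ (X (c b))), (hJ _).2 fun a => by
        rw [← hD, hf, map_zero]⟩
      map_add' := fun D D' => rfl
      map_smul' := fun x D => rfl }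
  have hΦ : Function.Bijective Φ := by
    constructor
    · rw [injective_iff_map_eq_zero]
      intro D h0
      have h1 : (fun b => D (σ (X (c b)))) = 0 := congrArg Subtype.val h0
      have h2 : ∀ g, D (σ g) = 0 := by
        intro g
        rw [hD, h1]
        simp [d]
      ext x
      obtain ⟨a, b, hb, hx⟩ := hσ x
      have h3 := congrArg D hx
      rw [D.leibniz, h2, h2, smul_zero, zero_add, smul_eq_mul] at h3
      exact (mul_eq_zero.1 h3).resolve_left hb
    · rintro ⟨w, hw⟩
      rw [hJ] at hw
      obtain ⟨D, hDw⟩ := exists_derivation_extending σ hσ (d w) (hd w) (by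
        intro g hg
        obtain ⟨s, hs, hsg⟩ := hker g hg
        -- Both vanishing statements are carried along, because the product rule for `r * h` needs
        -- `σ h = 0` as well as `d w h = 0`.
        have hspan : ∀ h ∈ Ideal.span (Set.range f), d w h = 0 ∧ σ h = 0 := by
          intro h hh
          induction hh using Submodule.span_induction with
          | mem h hh =>
            obtain ⟨a, rfl⟩ := hh
            exact ⟨hw a, hf a⟩
          | zero => simp
          | add g h _ _ hg hh => simp [hg.1, hg.2, hh.1, hh.2]
          | smul r h _ hh => simp [hd, hh.1, hh.2]
        have h0 := (hspan _ hsg).1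
        rw [hd, hg, zero_mul, add_zero] at h0
        exact (mul_eq_zero.1 h0).resolve_left hs)
      have hDM : ∀ x : M, D (algebraMap M E x) = 0 := by
        intro x
        have hx := hM x
        generalize algebraMap M E x = y at hx ⊢
        induction hx using Subfield.closure_induction with
        | mem y hy =>
          obtain ⟨g, ⟨x, rfl⟩ | ⟨v, hv, rfl⟩, rfl⟩ := hy
          · rw [hDw, hdC]
          · rw [hDw, hdX' _ v hv]
        | one => simp
        | add y z _ _ hy hz => rw [map_add, hy, hz, add_zero]
        | neg y _ hy => rw [map_neg, hy, neg_zero]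
        | inv y _ hy => rw [D.leibniz_inv, hy, smul_zero]
        | mul y z _ _ hy hz => rw [D.leibniz, hy, hz, smul_zero, smul_zero, add_zero]
      let D' : Derivation M E E := Derivation.mk'
        { toFun := D
          map_add' := map_add D
          map_smul' := fun x y => by
            rw [Algebra.smul_def, D.leibniz, hDM, smul_zero, add_zero, smul_eq_mul,
              RingHom.id_apply, Algebra.smul_def] } D.leibniz
      refine ⟨D', Subtype.ext (funext fun b => ?_)⟩
      change D (σ (X (c b))) = w b
      rw [hDw, hdX]
  let e := LinearEquiv.ofBijective Φ hΦ
  have : FiniteDimensional E (Derivation M E E) := Module.Finite.equiv e.symm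
  rw [trdeg_eq_finrank_derivation, e.finrank_eq]

/-- Additivity of the transcendence degree for a field extension given by a ring homomorphism. -/
theorem trdeg_add_trdeg_of_ringHom {K : Type*} {M L : Type u} [Field K] [Field M] [Field L]
    [Algebra K M] [Algebra K L] (φ : M →+* L)
    (h : ∀ x, φ (algebraMap K M x) = algebraMap K L x) :
    Algebra.trdeg K M + (letI := φ.toAlgebra; Algebra.trdeg M L) = Algebra.trdeg K L := by
  let _ := φ.toAlgebra
  have : IsScalarTower K M L := IsScalarTower.of_algebraMap_eq fun x => (h x).symm
  exact trdeg_add_eq K M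

end TranscendenceDegree

noncomputable section

namespace DAE

variable {K : Type*} [Field K] {n r : ℕ}

/-! ### The total derivative as a derivation, and the differential ideal generated by `F`. -/

section TotalDerivative

variable (δ : Derivation ℤ K K)

theorem coeff_coeffDeriv (g : DiffPoly K n) (m : Fin n × ℕ →₀ ℕ) :
    coeff m (coeffDeriv δ g) = δ (coeff m g) := by
  classical
  rw [coeffDeriv, coeff_sum]
  simp only [coeff_monomial]
  rw [Finset.sum_ite_eq' g.support m fun x => δ (coeff x g)]
  split_ifs with h
  · rfl
  · rw [notMem_support_iff.1 h, map_zero]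

theorem coeffDeriv_add (g h : DiffPoly K n) :
    coeffDeriv δ (g + h) = coeffDeriv δ g + coeffDeriv δ h := by
  ext m
  simp [coeff_coeffDeriv]

theorem coeffDeriv_mul (g h : DiffPoly K n) :
    coeffDeriv δ (g * h) = g * coeffDeriv δ h + h * coeffDeriv δ g := by
  classical
  ext m
  rw [coeff_coeffDeriv, mul_comm h, coeff_add, coeff_mul, coeff_mul, coeff_mul, map_sum,
    ← Finset.sum_add_distrib]
  refine Finset.sum_congr rfl fun x _ => ?_
  rw [coeff_coeffDeriv, coeff_coeffDeriv, δ.leibniz, smul_eq_mul, smul_eq_mul,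
    mul_comm (coeff x.2 h)]

/-- Sums over a common finite set of variables make the total derivatives of `g`, `h`, `g + h` and
`g * h` comparable. -/
theorem totalDeriv_eq_sum {g : DiffPoly K n} {s : Finset (Fin n × ℕ)} (hs : g.vars ⊆ s) :
    totalDeriv δ g = coeffDeriv δ g + ∑ v ∈ s, pderiv v g * X (v.1, v.2 + 1) := by
  rw [totalDeriv]
  congr 1
  refine Finset.sum_subset hs fun v _ hv => ?_
  rw [pderiv_eq_zero_of_notMem_vars hv, zero_mul]

theorem totalDeriv_add (g h : DiffPoly K n) :
    totalDeriv δ (g + h) = totalDeriv δ g + totalDeriv δ h := by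
  classical
  rw [totalDeriv_eq_sum δ (vars_add_subset g h),
    totalDeriv_eq_sum δ (Finset.subset_union_left (s₁ := g.vars) (s₂ := h.vars)),
    totalDeriv_eq_sum δ (Finset.subset_union_right (s₁ := g.vars) (s₂ := h.vars)), coeffDeriv_add]
  simp only [map_add, add_mul, Finset.sum_add_distrib]
  ring

theorem totalDeriv_mul (g h : DiffPoly K n) :
    totalDeriv δ (g * h) = g * totalDeriv δ h + h * totalDeriv δ g := by
  classical
  rw [totalDeriv_eq_sum δ (vars_mul g h),
    totalDeriv_eq_sum δ (Finset.subset_union_left (s₁ := g.vars) (s₂ := h.vars)),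
    totalDeriv_eq_sum δ (Finset.subset_union_right (s₁ := g.vars) (s₂ := h.vars)), coeffDeriv_mul,
    mul_add, mul_add, Finset.mul_sum, Finset.mul_sum]
  have : ∀ v : Fin n × ℕ, pderiv v (g * h) * X (v.1, v.2 + 1) =
      g * (pderiv v h * X (v.1, v.2 + 1)) + h * (pderiv v g * X (v.1, v.2 + 1)) := by
    intro v
    rw [pderiv_mul]
    ring
  simp only [this, Finset.sum_add_distrib]
  ring

theorem iterDeriv_mem_of_isDifferentialIdeal {P : Ideal (DiffPoly K n)}
    (hP : IsDifferentialIdeal δ P) {g : DiffPoly K n} (hg : g ∈ P) (p : ℕ) :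
    iterDeriv δ p g ∈ P := by
  induction p with
  | zero => exact hg
  | succ p ih =>
    rw [iterDeriv, Function.iterate_succ_apply']
    exact hP _ ih

/-- The ideal generated by the equations and all their total derivatives. -/
def diffIdeal (F : Fin r → DiffPoly K n) : Ideal (DiffPoly K n) :=
  Ideal.span {g | ∃ (p : ℕ) (j : Fin r), g = iterDeriv δ p (F j)}

theorem isDifferentialIdeal_diffIdeal (F : Fin r → DiffPoly K n) :
    IsDifferentialIdeal δ (diffIdeal δ F) := by
  intro g hg
  induction hg using Submodule.span_induction with
  | mem g hg =>
    obtain ⟨p, j, rfl⟩ := hg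
    refine Ideal.subset_span ⟨p + 1, j, ?_⟩
    rw [iterDeriv, iterDeriv, Function.iterate_succ_apply']
  | zero => simp [totalDeriv, coeffDeriv]
  | add g h _ _ hg hh => rw [totalDeriv_add]; exact add_mem hg hh
  | smul c g hg ih =>
    rw [smul_eq_mul, totalDeriv_mul]
    exact add_mem (Ideal.mul_mem_left _ _ ih) (Ideal.mul_mem_right _ _ hg)

theorem diffIdeal_le {F : Fin r → DiffPoly K n} {P : Ideal (DiffPoly K n)}
    (hP : IsDifferentialIdeal δ P) (hF : ∀ j, F j ∈ P) : diffIdeal δ F ≤ P := by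
  refine Ideal.span_le.2 ?_
  rintro _ ⟨p, j, rfl⟩
  exact iterDeriv_mem_of_isDifferentialIdeal δ hP (hF j) p

end TotalDerivative

/-! ### Membership in `Δ_q` and in the differential ideal, up to denominators. -/

section Generators

variable (δ : Derivation ℤ K K) (F : Fin r → DiffPoly K n)

/-- The total derivatives of order `< q` of the equations, as elements of `A_m`. -/
def derivs {q m : ℕ} (h : q + maxOrder F ≤ m + 1) (a : Fin q × Fin r) : A K n m :=
  ⟨iterDeriv δ a.1 (F a.2), iterDeriv_mem_A δ F a.2 (by have := a.1.2; omega)⟩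

variable (P : Ideal (DiffPoly K n)) [P.IsPrime]

theorem Delta_eq_span_range {q m : ℕ} (h : q + maxOrder F ≤ m + 1) :
    Delta δ F P q m =
      Ideal.span (Set.range fun a => algebraMap (A K n m) (B P m) (derivs δ F h a)) := by
  rw [Delta]
  congr 1
  ext b
  constructor
  · rintro ⟨p, j, hp, hq, rfl⟩
    exact ⟨(⟨p, hq⟩, j), rfl⟩
  · rintro ⟨a, rfl⟩
    exact ⟨a.1, a.2, _, a.1.2, rfl⟩

theorem Delta_eq_map {q m : ℕ} (h : q + maxOrder F ≤ m + 1) :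
    Delta δ F P q m =
      (Ideal.span (Set.range (derivs δ F h))).map (algebraMap (A K n m) (B P m)) := by
  rw [Delta_eq_span_range δ F P h, Ideal.map_span, ← Set.range_comp]
  rfl

theorem algebraMap_mem_Delta_iff {q m : ℕ} (h : q + maxOrder F ≤ m + 1) (x : A K n m) :
    algebraMap (A K n m) (B P m) x ∈ Delta δ F P q m ↔
      ∃ s : A K n m, (s : DiffPoly K n) ∉ P ∧ s * x ∈ Ideal.span (Set.range (derivs δ F h)) := by
  rw [Delta_eq_map δ F P h,
    IsLocalization.algebraMap_mem_map_algebraMap_iff (contr P m).primeCompl]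
  rfl

theorem coe_mem_diffIdeal {q m : ℕ} (h : q + maxOrder F ≤ m + 1) {x : A K n m}
    (hx : x ∈ Ideal.span (Set.range (derivs δ F h))) : (x : DiffPoly K n) ∈ diffIdeal δ F := by
  have hle : Ideal.span (Set.range (derivs δ F h)) ≤ (diffIdeal δ F).comap (A K n m).val := by
    refine Ideal.span_le.2 ?_
    rintro _ ⟨a, rfl⟩
    exact Ideal.subset_span ⟨a.1, a.2, rfl⟩
  exact hle hx

theorem exists_mem_A (g : DiffPoly K n) : ∃ m, g ∈ A K n m :=
  ⟨g.vars.sup Prod.snd, mem_supported.2 fun _ hv => Finset.le_sup (f := Prod.snd) hv⟩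

/-- An expression of `x` uses finitely many generators and coefficients, so it already lives in
`A_m` once `q` is large. -/
theorem exists_mem_span_derivs {x : DiffPoly K n} (hx : x ∈ diffIdeal δ F) :
    ∃ N, ∀ q m, N ≤ q → ∀ h : q + maxOrder F ≤ m + 1,
      ∃ y ∈ Ideal.span (Set.range (derivs δ F h)), (y : DiffPoly K n) = x := by
  induction hx using Submodule.span_induction with
  | mem x hx =>
    obtain ⟨p, j, rfl⟩ := hx
    exact ⟨p + 1, fun q m hq h => ⟨_, Ideal.subset_span ⟨(⟨p, hq⟩, j), rfl⟩, rfl⟩⟩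
  | zero => exact ⟨0, fun q m _ h => ⟨0, zero_mem _, rfl⟩⟩
  | add x y _ _ hx hy =>
    obtain ⟨N₁, h₁⟩ := hx
    obtain ⟨N₂, h₂⟩ := hy
    refine ⟨max N₁ N₂, fun q m hq h => ?_⟩
    obtain ⟨x', hx', rfl⟩ := h₁ q m (le_of_max_le_left hq) h
    obtain ⟨y', hy', rfl⟩ := h₂ q m (le_of_max_le_right hq) h
    exact ⟨x' + y', add_mem hx' hy', rfl⟩
  | smul c x _ hx =>
    obtain ⟨N₁, h₁⟩ := hx
    obtain ⟨N₂, h₂⟩ := exists_mem_A c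
    -- The condition on `m` only yields `q ≤ m + 1`, so `q ≥ N₂ + 1` is needed to have `c` in `A_m`.
    refine ⟨max N₁ (N₂ + 1), fun q m hq h => ?_⟩
    obtain ⟨x', hx', rfl⟩ := h₁ q m (le_of_max_le_left hq) h
    have := le_of_max_le_right hq
    exact ⟨⟨c, A_mono (by omega) h₂⟩ * x', Ideal.mul_mem_left _ _ hx', rfl⟩

end Generators

/-! ### Primality of `Δ_q` from quasi-regularity. -/

section Prime

variable (P : Ideal (DiffPoly K n)) [P.IsPrime]

/-- Quasi-regularity in terms of the residue field of `P`. -/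
theorem IsQuasiRegular.eq_zero_of_vecMul_eq_zero {δ : Derivation ℤ K K} {F : Fin r → DiffPoly K n}
    {P : Ideal (DiffPoly K n)} [P.IsPrime] (hreg : IsQuasiRegular δ F P) {q : ℕ}
    (y : Fin q × Fin r → P.ResidueField)
    (hy : ∀ v, ∑ a, y a * algebraMap (DiffPoly K n) P.ResidueField
      (pderiv v (iterDeriv δ a.1 (F a.2))) = 0) : y = 0 := by
  rcases Nat.eq_zero_or_pos q with rfl | hq
  · exact Subsingleton.elim _ _
  let ψ : (A K n (q - 1 + maxOrder F) ⧸ contr P (q - 1 + maxOrder F)) →+* P.ResidueField :=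
    (algebraMap (DiffPoly K n ⧸ P) P.ResidueField).comp
      (Ideal.quotientMap P (A K n (q - 1 + maxOrder F)).val.toRingHom le_rfl)
  have hψ : Function.Injective ψ :=
    (Ideal.injective_algebraMap_quotient_residueField P).comp Ideal.quotientMap_injective
  have hrank := Matrix.rank_map_of_injective ψ hψ
    ((fullJacobian δ F q).map (Ideal.Quotient.mk (contr P (q - 1 + maxOrder F))))
  rw [hreg q hq, ← Matrix.rank_transpose, Matrix.rank] at hrank
  -- The rank equals the number of rows, so rank-nullity for the transpose leaves no left kernel.
  have hker := LinearMap.finrank_range_add_finrank_ker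
    (((fullJacobian δ F q).map (Ideal.Quotient.mk (contr P (q - 1 + maxOrder F)))).map
      ψ).transpose.mulVecLin
  rw [hrank, Module.finrank_fintype_fun_eq_card, Fintype.card_prod, Fintype.card_fin,
    Fintype.card_fin, Nat.add_eq_left, Submodule.finrank_eq_zero] at hker
  rw [← Submodule.mem_bot P.ResidueField, ← hker, LinearMap.mem_ker, Matrix.mulVecLin_apply]
  ext b
  rw [Pi.zero_apply, ← hy (b.2, b.1)]
  refine Finset.sum_congr rfl fun a _ => ?_
  exact mul_comm _ _

instance (m : ℕ) : IsRegularRing (A K n m) := by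
  have : Finite {v : Fin n × ℕ | v.2 ≤ m} := by
    refine Set.Finite.subset ((Set.finite_univ (α := Fin n)).prod (Set.finite_Iic m)) ?_
    exact fun v hv => ⟨trivial, hv⟩
  exact IsRegularRing.of_ringEquiv
    (supportedEquivMvPolynomial (R := K) {v : Fin n × ℕ | v.2 ≤ m}).symm.toRingEquiv

instance (m : ℕ) : IsRegularLocalRing (B P m) :=
  IsRegularRing.isRegularLocalRing_localization (R := A K n m) (contr P m)

theorem map_contr_eq_maximalIdeal (m : ℕ) :
    (contr P m).map (algebraMap (A K n m) (B P m)) = IsLocalRing.maximalIdeal (B P m) :=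
  IsLocalization.AtPrime.map_eq_maximalIdeal (contr P m) (B P m)

theorem pderiv_mem_of_mem_sq {P : Ideal (DiffPoly K n)} {x : DiffPoly K n} (hx : x ∈ P ^ 2)
    (v : Fin n × ℕ) : pderiv v x ∈ P := by
  rw [pow_two] at hx
  refine Submodule.mul_induction_on hx (fun a ha b hb => ?_) fun a b ha hb => ?_
  · rw [pderiv_mul]
    exact add_mem (Ideal.mul_mem_left _ _ hb) (Ideal.mul_mem_right _ _ ha)
  · rw [map_add]
    exact add_mem ha hb

/-- A relation among the generators modulo the square of the maximal ideal becomes, after partial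
differentiation, a relation among the rows of the Jacobian modulo `P`; quasi-regularity excludes it.
Thus `B_m / Δ_q` is regular local. -/
theorem Delta_isPrime {δ : Derivation ℤ K K} {F : Fin r → DiffPoly K n}
    {P : Ideal (DiffPoly K n)} [P.IsPrime]
    (hP : IsDifferentialIdeal δ P) (hF : ∀ j, F j ∈ P) (hreg : IsQuasiRegular δ F P) {q m : ℕ}
    (h : q + maxOrder F ≤ m + 1) : (Delta δ F P q m).IsPrime := by
  have hfP : ∀ a : Fin q × Fin r, iterDeriv δ a.1 (F a.2) ∈ P := fun a =>
    iterDeriv_mem_of_isDifferentialIdeal δ hP (hF a.2) a.1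
  have hmem : ∀ a, algebraMap (A K n m) (B P m) (derivs δ F h a) ∈
      IsLocalRing.maximalIdeal (B P m) := fun a => by
    rw [← map_contr_eq_maximalIdeal]
    exact Ideal.mem_map_of_mem _ (hfP a)
  have hf := linearIndependent_toCotangent_of_isLocalization (S := B P m) (contr P m)
    (derivs δ F h) hmem (by
      intro c t ht hts
      have hts' : ((t * ∑ a, c a * derivs δ F h a : A K n m) : DiffPoly K n) ∈ P ^ 2 :=
        Ideal.le_comap_pow (A K n m).val 2 hts
      have hzero :
          (fun a => algebraMap (DiffPoly K n) P.ResidueField (c a : DiffPoly K n)) = 0 := by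
        refine hreg.eq_zero_of_vecMul_eq_zero _ fun v => ?_
        -- Since the generators lie in `P`, only the terms `t * c a * ∂f_a` survive modulo `P`, and
        -- `t` can be cancelled.
        have h0 := pderiv_mem_of_mem_sq hts' v
        rw [← Ideal.algebraMap_residueField_eq_zero] at h0
        have hf0 : ∀ a : Fin q × Fin r, algebraMap (DiffPoly K n) P.ResidueField
            (iterDeriv δ a.1 (F a.2)) = 0 := fun a =>
          Ideal.algebraMap_residueField_eq_zero.2 (hfP a)
        have ht0 : (t : DiffPoly K n) ∉ P := ht
        simpa [derivs, pderiv_mul, hf0, ht0] using h0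
      exact fun a => (mem_contr P (c a)).2
        (Ideal.algebraMap_residueField_eq_zero.1 (congrFun hzero a)))
  have hreg' := IsRegularLocalRing.quotient_span _ hf (Delta_eq_span_range δ F P h)
  exact (Ideal.Quotient.isDomain_iff_prime _).1 hreg'.isDomain

end Prime

/-! ### `P` as the saturation of the differential ideal generated by `F`. -/

section Minimality

variable {δ : Derivation ℤ K K} {F : Fin r → DiffPoly K n} {P : Ideal (DiffPoly K n)} [P.IsPrime]

/-- The elements that a denominator outside `P` multiplies into the ideal generated by the equations
and all their total derivatives. -/
def saturation (δ : Derivation ℤ K K) (F : Fin r → DiffPoly K n) (P : Ideal (DiffPoly K n))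
    [P.IsPrime] : Ideal (DiffPoly K n) where
  carrier := {g | ∃ h ∉ P, h * g ∈ diffIdeal δ F}
  zero_mem' := ⟨1, fun h => Ideal.IsPrime.ne_top' ((Ideal.eq_top_iff_one P).2 h), by simp⟩
  add_mem' := by
    rintro a b ⟨s, hs, hsa⟩ ⟨t, ht, htb⟩
    refine ⟨s * t, fun hst => (Ideal.IsPrime.mem_or_mem ‹_› hst).elim hs ht, ?_⟩
    have : s * t * (a + b) = t * (s * a) + s * (t * b) := by ring
    rw [this]
    exact add_mem (Ideal.mul_mem_left _ _ hsa) (Ideal.mul_mem_left _ _ htb)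
  smul_mem' := by
    rintro c a ⟨s, hs, hsa⟩
    refine ⟨s, hs, ?_⟩
    rw [smul_eq_mul, mul_left_comm]
    exact Ideal.mul_mem_left _ _ hsa

/-- A product in the saturation lies, for a large `m`, in some `Δ_N` of `B_m`, which is prime; one
factor is then in `Δ_N`, hence in the saturation. -/
theorem saturation_isPrime (hP : IsDifferentialIdeal δ P) (hF : ∀ j, F j ∈ P)
    (hreg : IsQuasiRegular δ F P) : (saturation δ F P).IsPrime := by
  constructor
  · rw [Ne, Ideal.eq_top_iff_one]
    rintro ⟨h, hh, h1⟩
    rw [mul_one] at h1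
    exact hh (diffIdeal_le δ hP hF h1)
  · rintro a b ⟨h, hh, hab⟩
    obtain ⟨N, hN⟩ := exists_mem_span_derivs δ F hab
    obtain ⟨N₁, h₁⟩ := exists_mem_A a
    obtain ⟨N₂, h₂⟩ := exists_mem_A b
    obtain ⟨N₃, h₃⟩ := exists_mem_A h
    obtain ⟨m, hm⟩ : ∃ m, m = N + maxOrder F + N₁ + N₂ + N₃ := ⟨_, rfl⟩
    have hNm : N + maxOrder F ≤ m + 1 := by omega
    obtain ⟨y, hy, hyab⟩ := hN N m le_rfl hNm
    let a' : A K n m := ⟨a, A_mono (by omega) h₁⟩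
    let b' : A K n m := ⟨b, A_mono (by omega) h₂⟩
    let h' : A K n m := ⟨h, A_mono (by omega) h₃⟩
    have hmem : algebraMap (A K n m) (B P m) (a' * b') ∈ Delta δ F P N m := by
      rw [algebraMap_mem_Delta_iff δ F P hNm]
      refine ⟨h', hh, ?_⟩
      convert hy
      exact Subtype.ext hyab.symm
    have hback : ∀ x : A K n m, algebraMap (A K n m) (B P m) x ∈ Delta δ F P N m →
        (x : DiffPoly K n) ∈ saturation δ F P := by
      intro x hx
      obtain ⟨s, hs, hsx⟩ := (algebraMap_mem_Delta_iff δ F P hNm x).1 hx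
      exact ⟨s, hs, coe_mem_diffIdeal δ F hNm hsx⟩
    rw [map_mul] at hmem
    exact ((Delta_isPrime hP hF hreg hNm).mem_or_mem hmem).imp (hback a') (hback b')

theorem isDifferentialIdeal_saturation : IsDifferentialIdeal δ (saturation δ F P) := by
  rintro g ⟨h, hh, hg⟩
  -- Squaring the denominator works because `h² g' = h (hg)' - h' (hg)`, where the prime denotes the
  -- total derivative.
  refine ⟨h * h, fun h2 => (Ideal.IsPrime.mem_or_mem ‹_› h2).elim hh hh, ?_⟩
  have h1 := isDifferentialIdeal_diffIdeal δ F _ hg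
  rw [totalDeriv_mul] at h1
  have : h * h * totalDeriv δ g =
      h * (h * totalDeriv δ g + g * totalDeriv δ h) - totalDeriv δ h * (h * g) := by ring
  rw [this]
  exact sub_mem (Ideal.mul_mem_left _ _ h1) (Ideal.mul_mem_left _ _ hg)

/-- The saturation is a prime differential ideal containing `F` and contained in `P`, so minimality
forces equality. -/
theorem le_saturation (hmin : IsMinimalPrimeDifferential δ F P) (hreg : IsQuasiRegular δ F P) :
    P ≤ saturation δ F P := by
  obtain ⟨-, hP, hF⟩ := hmin.1
  refine hmin.2 ⟨saturation_isPrime hP hF hreg, isDifferentialIdeal_saturation, fun j => ?_⟩ ?_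
  · exact ⟨1, fun h => Ideal.IsPrime.ne_top' ((Ideal.eq_top_iff_one P).2 h), by
      rw [one_mul]; exact Ideal.subset_span ⟨0, j, rfl⟩⟩
  · rintro g ⟨h, hh, hg⟩
    exact (Ideal.IsPrime.mem_or_mem ‹_› (diffIdeal_le δ hP hF hg)).resolve_left hh

/-- An element of `P` lies in the ideals `Δ_q` for all large `q`. -/
theorem exists_forall_mem_Delta (hmin : IsMinimalPrimeDifferential δ F P)
    (hreg : IsQuasiRegular δ F P) {g : DiffPoly K n} (hg : g ∈ P) :
    ∃ N, ∀ q m, N ≤ q → q + maxOrder F ≤ m + 1 → ∀ hgm : g ∈ A K n m,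
      algebraMap (A K n m) (B P m) ⟨g, hgm⟩ ∈ Delta δ F P q m := by
  obtain ⟨h, hh, hhg⟩ := le_saturation hmin hreg hg
  obtain ⟨N, hN⟩ := exists_mem_span_derivs δ F hhg
  obtain ⟨N', hN'⟩ := exists_mem_A h
  refine ⟨max N (N' + 1), fun q m hq hqm hgm => ?_⟩
  obtain ⟨y, hy, hyg⟩ := hN q m (le_of_max_le_left hq) hqm
  have := le_of_max_le_right hq
  rw [algebraMap_mem_Delta_iff δ F P hqm]
  refine ⟨⟨h, A_mono (by omega) hN'⟩, hh, ?_⟩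
  convert hy
  exact Subtype.ext hyg.symm

theorem algebraMap_notMem_Delta (hP : IsDifferentialIdeal δ P) (hF : ∀ j, F j ∈ P) {q m : ℕ}
    (h : q + maxOrder F ≤ m + 1) {x : A K n m} (hx : (x : DiffPoly K n) ∉ P) :
    algebraMap (A K n m) (B P m) x ∉ Delta δ F P q m := by
  intro hmem
  obtain ⟨s, hs, hsx⟩ := (algebraMap_mem_Delta_iff δ F P h x).1 hmem
  exact (Ideal.IsPrime.mem_or_mem ‹_›
    (diffIdeal_le δ hP hF (coe_mem_diffIdeal δ F h hsx))).elim hs hx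

end Minimality

/-! ### Comparison of the ranks of `𝔍_{k,i}` modulo `Δ` and over the residue field of `P`. -/

section Rank

variable {δ : Derivation ℤ K K} {F : Fin r → DiffPoly K n} {P : Ideal (DiffPoly K n)} [P.IsPrime]

theorem le_rank_residueField_iff (k i t : ℕ) :
    t ≤ ((pseudoJacobian δ F k i).map (algebraMap (DiffPoly K n) P.ResidueField)).rank ↔
      ∃ u v, ((pseudoJacobian δ F k i).submatrix (u : Fin t → _) (v : Fin t → _)).det ∉ P := by
  rw [Matrix.le_rank_iff_exists_det_submatrix_ne_zero]
  refine exists_congr fun u => exists_congr fun v => ?_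
  rw [Matrix.submatrix_map, ← RingHom.mapMatrix_apply, ← RingHom.map_det, Ne,
    Ideal.algebraMap_residueField_eq_zero]

theorem det_submatrix_pseudoJacobian_mem_A {k i m t : ℕ} (hi : maxOrder F ≤ i + 1) (hm : i + k ≤ m)
    (u : Fin t → Fin k × Fin r) (v : Fin t → Fin k × Fin n) :
    ((pseudoJacobian δ F k i).submatrix u v).det ∈ A K n m := by
  rw [Matrix.det_apply]
  exact sum_mem fun τ _ => Subalgebra.zsmul_mem _ (prod_mem fun a _ =>
    pseudoJacobian_mem_A δ F hi hm _ _) _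

theorem le_rankMod_iff {k i s : ℕ} (hi : maxOrder F ≤ i + 1)
    (hprime : (Delta δ F P (i + 1 - maxOrder F + k + s) (i + k + s)).IsPrime) (t : ℕ) :
    t ≤ rankMod δ F P k i s hi ↔ ∃ u v, algebraMap (A K n (i + k + s)) (B P (i + k + s))
      ⟨((pseudoJacobian δ F k i).submatrix (u : Fin t → _) (v : Fin t → _)).det,
        det_submatrix_pseudoJacobian_mem_A hi (Nat.le_add_right _ s) u v⟩ ∉
      Delta δ F P (i + 1 - maxOrder F + k + s) (i + k + s) := by
  let R := B P (i + k + s) ⧸ Delta δ F P (i + 1 - maxOrder F + k + s) (i + k + s)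
  have : IsDomain R := (Ideal.Quotient.isDomain_iff_prime _).2 hprime
  let J : Matrix (Fin k × Fin r) (Fin k × Fin n) (A K n (i + k + s)) := fun a b =>
    ⟨pseudoJacobian δ F k i a b, pseudoJacobian_mem_A δ F hi (Nat.le_add_right _ s) a b⟩
  let φ : A K n (i + k + s) →+* R := (Ideal.Quotient.mk _).comp
    (algebraMap (A K n (i + k + s)) (B P (i + k + s)))
  change t ≤ (J.map φ).rank ↔ _
  rw [← Matrix.rank_map_of_injective (algebraMap R (FractionRing R))
    (IsFractionRing.injective R _), Matrix.le_rank_iff_exists_det_submatrix_ne_zero]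
  refine exists_congr fun u => exists_congr fun v => ?_
  rw [Matrix.submatrix_map, Matrix.submatrix_map, ← RingHom.mapMatrix_apply,
    ← RingHom.mapMatrix_apply, ← RingHom.map_det, ← RingHom.map_det, Ne,
    map_eq_zero_iff _ (IsFractionRing.injective R _)]
  have hdet : (J.submatrix u v).det = ⟨((pseudoJacobian δ F k i).submatrix u v).det,
      det_submatrix_pseudoJacobian_mem_A hi (Nat.le_add_right _ s) u v⟩ := by
    refine Subtype.ext ?_
    exact RingHom.map_det (A K n (i + k + s)).val.toRingHom (J.submatrix u v)
  rw [hdet]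
  exact not_congr Ideal.Quotient.eq_zero_iff_mem

/-- Under the constant rank hypothesis the rank of `𝔍_{k,i}` over the residue field of `P` is its
rank over `B_{i+k} / Δ_{i-e+1+k}`. -/
theorem rank_residueField_eq_rankMod (hmin : IsMinimalPrimeDifferential δ F P)
    (hreg : IsQuasiRegular δ F P) (hrank : HasConstantRanks δ F P) {k i : ℕ}
    (hi : maxOrder F ≤ i + 1) :
    ((pseudoJacobian δ F k i).map (algebraMap (DiffPoly K n) P.ResidueField)).rank =
      rankMod δ F P k i 0 hi := by
  obtain ⟨-, hP, hF⟩ := hmin.1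
  have hprime : ∀ s, (Delta δ F P (i + 1 - maxOrder F + k + s) (i + k + s)).IsPrime := fun s =>
    Delta_isPrime hP hF hreg (by omega)
  refine le_antisymm ?_ ?_
  · obtain ⟨u, v, huv⟩ := (le_rank_residueField_iff (P := P) (δ := δ) (F := F) k i _).1 le_rfl
    exact (le_rankMod_iff hi (hprime 0) _).2
      ⟨u, v, algebraMap_notMem_Delta hP hF (by omega) huv⟩
  · rw [le_rank_residueField_iff]
    by_contra! hcon
    choose N hN using fun u v => exists_forall_mem_Delta hmin hreg (hcon u v)
    -- There are finitely many minors of the given size; if all were in `P`, a single `s` would put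
    -- them all in `Δ`, lowering the supposedly constant rank.
    let s := Finset.univ.sup fun uv : _ × _ => N uv.1 uv.2
    obtain ⟨u, v, huv⟩ := (le_rankMod_iff hi (hprime s) _).1 (hrank k i hi 0 s).le
    refine huv (hN u v _ _ ?_ (by omega) _)
    have : N u v ≤ s := Finset.le_sup (f := fun uv : _ × _ => N uv.1 uv.2)
      (Finset.mem_univ (u, v))
    omega

theorem rank_add_mu (k i : ℕ) :
    ((pseudoJacobian δ F k i).map (algebraMap (DiffPoly K n) P.ResidueField)).rank +
      mu δ F P k i = k * r := by
  have h := LinearMap.finrank_range_add_finrank_ker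
    ((pseudoJacobian δ F k i).map (algebraMap (DiffPoly K n) P.ResidueField)).transpose.mulVecLin
  rw [Module.finrank_fintype_fun_eq_card, Fintype.card_prod, Fintype.card_fin,
    Fintype.card_fin] at h
  rw [← Matrix.rank_transpose, mu]
  -- For `k = 0` the matrix is empty, so its rank is zero and the convention for `μ` is consistent.
  split_ifs with hk
  · subst hk
    rw [Nat.zero_mul] at h ⊢
    exact (Nat.add_eq_zero_iff.1 h).1
  · exact h

end Rank

/-! ### Fraction fields of `B_m / Δ_q` and the Jacobian criterion for them. -/

section FractionField

variable {δ : Derivation ℤ K K} {F : Fin r → DiffPoly K n} {P : Ideal (DiffPoly K n)} [P.IsPrime]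

/-- The canonical map from `A_m` to the fraction field of `B_m / I`. -/
def toFrac (P : Ideal (DiffPoly K n)) [P.IsPrime] {m : ℕ} (I : Ideal (B P m)) :
    A K n m →+* FractionRing (B P m ⧸ I) :=
  ((algebraMap (B P m ⧸ I) (FractionRing (B P m ⧸ I))).comp (Ideal.Quotient.mk I)).comp
    (algebraMap (A K n m) (B P m))

theorem toFrac_eq_zero_iff {m : ℕ} (I : Ideal (B P m)) (x : A K n m) :
    toFrac P I x = 0 ↔ algebraMap (A K n m) (B P m) x ∈ I := by
  rw [← Ideal.Quotient.eq_zero_iff_mem]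
  exact map_eq_zero_iff _ (IsFractionRing.injective (B P m ⧸ I) (FractionRing (B P m ⧸ I)))

theorem exists_mul_toFrac_eq {m : ℕ} (I : Ideal (B P m)) [I.IsPrime]
    (x : FractionRing (B P m ⧸ I)) :
    ∃ a b, toFrac P I b ≠ 0 ∧ x * toFrac P I b = toFrac P I a := by
  obtain ⟨y, z, hz, rfl⟩ := IsFractionRing.div_surjective (A := B P m ⧸ I) x
  obtain ⟨y, rfl⟩ := Ideal.Quotient.mk_surjective y
  obtain ⟨z, rfl⟩ := Ideal.Quotient.mk_surjective z
  obtain ⟨⟨a, s⟩, ha⟩ := IsLocalization.surj (contr P m).primeCompl y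
  obtain ⟨⟨b, t⟩, hb⟩ := IsLocalization.surj (contr P m).primeCompl z
  let θ : B P m →+* FractionRing (B P m ⧸ I) :=
    (algebraMap (B P m ⧸ I) (FractionRing (B P m ⧸ I))).comp (Ideal.Quotient.mk I)
  have hθz : θ z ≠ 0 := by
    intro h0
    refine nonZeroDivisors.ne_zero hz ?_
    exact (map_eq_zero_iff _ (IsFractionRing.injective (B P m ⧸ I) (FractionRing (B P m ⧸ I)))).1 h0
  have hs : toFrac P I s ≠ 0 := ((IsLocalization.map_units (B P m) s).map θ).ne_zero
  have ht : toFrac P I t ≠ 0 := ((IsLocalization.map_units (B P m) t).map θ).ne_zero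
  have ha' : θ y * toFrac P I s = toFrac P I a := by
    have := congrArg θ ha
    rwa [map_mul] at this
  have hb' : θ z * toFrac P I t = toFrac P I b := by
    have := congrArg θ hb
    rwa [map_mul] at this
  refine ⟨a * t, s * b, ?_, ?_⟩
  · rw [map_mul, ← hb']
    exact mul_ne_zero hs (mul_ne_zero hθz ht)
  · rw [map_mul, map_mul, ← ha', ← hb']
    change θ y / θ z * _ = _
    field_simp

/-- The transcendence degree of a field generated by the image of `A_m` over a subfield generated by
the images of the constants and of some of the variables. -/
theorem trdeg_eq_finrank_ker_of_supported {m : ℕ} {M E ι β : Type*} [Field M] [CharZero M]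
    [Field E] [Algebra M E] [Fintype β] (τ : A K n m →+* E)
    (hτ : ∀ x, ∃ a b, τ b ≠ 0 ∧ x * τ b = τ a) (f : ι → A K n m)
    (hker : ∀ g, τ g = 0 → ∃ s, τ s ≠ 0 ∧ s * g ∈ Ideal.span (Set.range f))
    (hf : ∀ a, τ (f a) = 0)
    (c : β → Fin n × ℕ) (hcm : ∀ b, (c b).2 ≤ m) (hc : Function.Injective c)
    (hM : ∀ x : M, algebraMap M E x ∈ Subfield.closure (τ '' (Set.range (algebraMap K (A K n m)) ∪
        {g | ∃ v ∉ Set.range c, (g : DiffPoly K n) = X v})))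
    (hMC : ∀ x : K, τ (algebraMap K (A K n m) x) ∈ Set.range (algebraMap M E))
    (hMX : ∀ v ∉ Set.range c, ∀ hv : X v ∈ A K n m, τ ⟨X v, hv⟩ ∈ Set.range (algebraMap M E)) :
    Algebra.trdeg M E = Module.finrank E (LinearMap.ker
      (Matrix.of fun (a : ι) (b : β) =>
        τ ⟨pderiv (c b) (f a : DiffPoly K n), pderiv_mem_A (f a).2 _⟩).mulVecLin) := by
  let ε := supportedEquivMvPolynomial (R := K) {v : Fin n × ℕ | v.2 ≤ m}
  have hε : ∀ g, ((ε.symm g : A K n m) : DiffPoly K n) = rename (↑) g := fun g => by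
    simp [ε, supportedEquivMvPolynomial]
  let c' : β → {v : Fin n × ℕ | v.2 ≤ m} := fun b => ⟨c b, hcm b⟩
  have hc' : Function.Injective c' := fun b b' hb => hc (congrArg Subtype.val hb)
  have hrange : ∀ v : {v : Fin n × ℕ | v.2 ≤ m},
      v ∉ Set.range c' ↔ (v : Fin n × ℕ) ∉ Set.range c := by
    intro v
    refine not_congr ⟨?_, ?_⟩
    · rintro ⟨b, rfl⟩
      exact ⟨b, rfl⟩
    · rintro ⟨b, hb⟩
      exact ⟨b, Subtype.ext hb⟩
  let σ : MvPolynomial {v : Fin n × ℕ | v.2 ≤ m} K →+* E := τ.comp (ε.symm : _ →+* A K n m)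
  have hσε : ∀ a, σ (ε a) = τ a := fun a => congrArg τ (ε.symm_apply_apply a)
  have hX : ∀ v, ((ε.symm (X v) : A K n m) : DiffPoly K n) = X (v : Fin n × ℕ) := by
    intro v
    rw [hε, rename_X]
  have hC : ∀ x, ε.symm (C x) = algebraMap K (A K n m) x := fun x => ε.symm.commutes x
  have hJ : (fun (a : ι) (b : β) => σ (pderiv (c' b) (ε (f a)))) = fun a b =>
      τ ⟨pderiv (c b) (f a : DiffPoly K n), pderiv_mem_A (f a).2 _⟩ := by
    funext a b
    refine congrArg τ (Subtype.ext ?_)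
    refine (hε _).trans ?_
    rw [← pderiv_rename Subtype.val_injective, ← hε, ε.symm_apply_apply]
  rw [← hJ]
  refine trdeg_eq_finrank_ker_jacobian (M := M) σ ?_ (fun a => ε (f a)) ?_ ?_ c' hc' ?_ ?_ ?_
  · intro x
    obtain ⟨a, b, hb, hab⟩ := hτ x
    exact ⟨ε a, ε b, by rwa [hσε], by rwa [hσε, hσε]⟩
  · intro g hg
    obtain ⟨g, rfl⟩ := ε.surjective g
    rw [hσε] at hg
    obtain ⟨s, hs, hsg⟩ := hker g hg
    refine ⟨ε s, by rwa [hσε], ?_⟩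
    have := Ideal.mem_map_of_mem ε hsg
    rw [Ideal.map_span, ← Set.range_comp] at this
    rw [← map_mul]
    exact this
  · intro a
    rw [hσε, hf]
  · intro x
    refine Subfield.closure_mono ?_ (hM x)
    rintro _ ⟨g, ⟨y, rfl⟩ | ⟨v, hv, hgv⟩, rfl⟩
    · exact ⟨C y, Or.inl ⟨y, rfl⟩, congrArg τ (hC y)⟩
    · have hvm : v.2 ≤ m := by
        have := g.2
        rwa [hgv, X_mem_supported] at this
      refine ⟨X ⟨v, hvm⟩, Or.inr ⟨_, (hrange _).2 hv, rfl⟩, congrArg τ ?_⟩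
      exact Subtype.ext ((hX _).trans hgv.symm)
  · intro x
    have := hMC x
    rw [← hC] at this
    exact this
  · intro v hv
    have hXv : (ε.symm (X v)) = ⟨X (v : Fin n × ℕ), X_mem_supported.2 v.2⟩ := Subtype.ext (hX v)
    have := hMX v ((hrange v).1 hv) (X_mem_supported.2 v.2)
    rw [← hXv] at this
    exact this

/-- The transcendence degree of the fraction field of `B_m / Δ_q` over a subfield generated by some
of the variables is the dimension of the kernel of a part of the Jacobian matrix. -/
theorem trdeg_fractionRing_eq_finrank_ker (hP : IsDifferentialIdeal δ P) (hF : ∀ j, F j ∈ P)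
    {q m : ℕ} (h : q + maxOrder F ≤ m + 1) [(Delta δ F P q m).IsPrime]
    {M β : Type*} [Field M] [CharZero M] [Fintype β]
    [Algebra M (FractionRing (B P m ⧸ Delta δ F P q m))]
    (c : β → Fin n × ℕ) (hcm : ∀ b, (c b).2 ≤ m) (hc : Function.Injective c)
    (hM : ∀ x : M, algebraMap M (FractionRing (B P m ⧸ Delta δ F P q m)) x ∈
      Subfield.closure (toFrac P (Delta δ F P q m) '' (Set.range (algebraMap K (A K n m)) ∪
        {g | ∃ v ∉ Set.range c, (g : DiffPoly K n) = X v})))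
    (hMC : ∀ x : K, toFrac P (Delta δ F P q m) (algebraMap K (A K n m) x) ∈
      Set.range (algebraMap M (FractionRing (B P m ⧸ Delta δ F P q m))))
    (hMX : ∀ v ∉ Set.range c, ∀ hv : X v ∈ A K n m, toFrac P (Delta δ F P q m) ⟨X v, hv⟩ ∈
      Set.range (algebraMap M (FractionRing (B P m ⧸ Delta δ F P q m)))) :
    Algebra.trdeg M (FractionRing (B P m ⧸ Delta δ F P q m)) =
      Module.finrank (FractionRing (B P m ⧸ Delta δ F P q m)) (LinearMap.ker
        (Matrix.of fun (a : Fin q × Fin r) (b : β) => toFrac P (Delta δ F P q m)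
          ⟨pderiv (c b) (derivs δ F h a : DiffPoly K n),
            pderiv_mem_A (derivs δ F h a).2 _⟩).mulVecLin) := by
  refine trdeg_eq_finrank_ker_of_supported _ (exists_mul_toFrac_eq _) (derivs δ F h) ?_ ?_ c hcm hc
    hM hMC hMX
  · intro g hg
    rw [toFrac_eq_zero_iff, algebraMap_mem_Delta_iff δ F P h] at hg
    obtain ⟨s, hs, hsg⟩ := hg
    refine ⟨s, ?_, hsg⟩
    rw [Ne, toFrac_eq_zero_iff]
    exact algebraMap_notMem_Delta hP hF h hs
  · intro a
    rw [toFrac_eq_zero_iff, Delta_eq_span_range δ F P h]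
    exact Ideal.subset_span ⟨a, rfl⟩

theorem pderiv_eq_zero_of_mem_A {m : ℕ} {g : DiffPoly K n} (hg : g ∈ A K n m) {v : Fin n × ℕ}
    (hv : m < v.2) : pderiv v g = 0 :=
  pderiv_eq_zero_of_notMem_vars fun h => (mem_supported.1 hg h).not_gt hv

/-- The transcendence degree of the fraction field of `B_m / Δ_q` over `K`. -/
theorem trdeg_fractionRing [CharZero K] (hP : IsDifferentialIdeal δ P) (hF : ∀ j, F j ∈ P)
    (hreg : IsQuasiRegular δ F P) {q m : ℕ} (h : q + maxOrder F ≤ m + 1)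
    [(Delta δ F P q m).IsPrime] :
    ∃ t : ℕ, Algebra.trdeg K (FractionRing (B P m ⧸ Delta δ F P q m)) = t ∧
      t + q * r = (m + 1) * n := by
  let c : Fin (m + 1) × Fin n → Fin n × ℕ := fun b => (b.2, b.1)
  have hcm : ∀ b, (c b).2 ≤ m := fun b => Nat.lt_succ_iff.1 b.1.2
  have hc : Function.Injective c := by
    rintro ⟨a, b⟩ ⟨a', b'⟩ hab
    simp only [c, Prod.mk.injEq] at hab
    exact Prod.ext (Fin.ext hab.2) hab.1
  have hc' : ∀ v : Fin n × ℕ, v.2 ≤ m → v ∈ Set.range c := fun v hv =>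
    ⟨(⟨v.2, Nat.lt_succ_of_le hv⟩, v.1), rfl⟩
  refine ⟨_, trdeg_fractionRing_eq_finrank_ker hP hF h c hcm hc ?_ ?_ ?_, ?_⟩
  · intro x
    exact Subfield.subset_closure ⟨_, Or.inl ⟨x, rfl⟩, rfl⟩
  · intro x
    exact ⟨x, rfl⟩
  · intro v hv hvm
    exact absurd (hc' v (X_mem_supported (R := K) (s := {v : Fin n × ℕ | v.2 ≤ m}).1 hvm)) hv
  · let J : Matrix (Fin q × Fin r) (Fin (m + 1) × Fin n) (A K n m) := fun a b =>
      ⟨pderiv (c b) (derivs δ F h a : DiffPoly K n), pderiv_mem_A (derivs δ F h a).2 _⟩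
    let ρ : A K n m →+* P.ResidueField :=
      (algebraMap (DiffPoly K n) P.ResidueField).comp (A K n m).val.toRingHom
    have hρ : (J.map ρ).rank = q * r := by
      rw [← Matrix.rank_transpose]
      have hker : LinearMap.ker (J.map ρ).transpose.mulVecLin = ⊥ := by
        rw [LinearMap.ker_eq_bot']
        intro y hy
        refine hreg.eq_zero_of_vecMul_eq_zero y fun v => ?_
        by_cases hv : v.2 ≤ m
        · obtain ⟨b, rfl⟩ := hc' v hv
          refine Eq.trans ?_ (congrFun hy b)
          exact Finset.sum_congr rfl fun a _ => mul_comm _ _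
        · refine Finset.sum_eq_zero fun a _ => ?_
          have := pderiv_eq_zero_of_mem_A (derivs δ F h a).2 (not_le.1 hv)
          simp only [derivs] at this
          rw [this, map_zero, mul_zero]
      have := LinearMap.finrank_range_add_finrank_ker (J.map ρ).transpose.mulVecLin
      rw [hker, finrank_bot, add_zero, Module.finrank_fintype_fun_eq_card, Fintype.card_prod,
        Fintype.card_fin, Fintype.card_fin] at this
      exact this
    -- A minor of full size that is nonzero modulo `P` stays nonzero modulo `Δ_q`, because elements
    -- of `A_m` in `Δ_q` lie in `P`.
    have hrank : (J.map (toFrac P (Delta δ F P q m))).rank = q * r := by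
      refine le_antisymm ?_ ?_
      · simpa using (J.map (toFrac P (Delta δ F P q m))).rank_le_card_height
      · obtain ⟨u, v, huv⟩ :=
          (Matrix.le_rank_iff_exists_det_submatrix_ne_zero (J.map ρ) (q * r)).1 hρ.ge
        rw [Matrix.le_rank_iff_exists_det_submatrix_ne_zero]
        refine ⟨u, v, ?_⟩
        rw [Matrix.submatrix_map, ← RingHom.mapMatrix_apply, ← RingHom.map_det] at huv ⊢
        rw [Ne, toFrac_eq_zero_iff]
        refine algebraMap_notMem_Delta hP hF h fun h0 => huv ?_
        exact Ideal.algebraMap_residueField_eq_zero.2 h0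
    have := LinearMap.finrank_range_add_finrank_ker
      (J.map (toFrac P (Delta δ F P q m))).mulVecLin
    rw [Module.finrank_fintype_fun_eq_card, Fintype.card_prod, Fintype.card_fin,
      Fintype.card_fin] at this
    rw [← this, ← hrank, add_comm]
    rfl

end FractionField

/-! ### The tower `K ⊆ Frac(B_i / (Δ ∩ B_i)) ⊆ Frac(B_{i+k} / Δ)`. -/

section Tower

variable {δ : Derivation ℤ K K} {F : Fin r → DiffPoly K n} {P : Ideal (DiffPoly K n)} [P.IsPrime]

theorem inclB_algebraMap {i m : ℕ} (h : i ≤ m) (a : A K n i) :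
    inclB P h (algebraMap (A K n i) (B P i) a) =
      algebraMap (A K n m) (B P m) (inclA K n h a) :=
  IsLocalization.map_eq (primeCompl_le_comap_inclA P h) a

/-- The embedding of the fraction field of `B_i / (I ∩ B_i)` into that of `B_m / I`. -/
def fracMap {i m : ℕ} (h : i ≤ m) (I : Ideal (B P m)) [I.IsPrime] :
    FractionRing (B P i ⧸ I.comap (inclB P h)) →+* FractionRing (B P m ⧸ I) :=
  IsFractionRing.map (Ideal.quotientMap_injective (I := I) (f := inclB P h))

theorem fracMap_algebraMap {i m : ℕ} (h : i ≤ m) (I : Ideal (B P m)) [I.IsPrime] (b : B P i) :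
    fracMap h I (algebraMap _ _ (Ideal.Quotient.mk (I.comap (inclB P h)) b)) =
      algebraMap _ _ (Ideal.Quotient.mk I (inclB P h b)) :=
  IsLocalization.map_eq (M := nonZeroDivisors (B P i ⧸ I.comap (inclB P h)))
    (T := nonZeroDivisors (B P m ⧸ I)) (g := Ideal.quotientMap I (inclB P h) le_rfl)
    (nonZeroDivisors_le_comap_nonZeroDivisors_of_injective _ Ideal.quotientMap_injective) _

theorem fracMap_toFrac {i m : ℕ} (h : i ≤ m) (I : Ideal (B P m)) [I.IsPrime] (a : A K n i) :
    fracMap h I (toFrac P (I.comap (inclB P h)) a) = toFrac P I (inclA K n h a) := by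
  refine (fracMap_algebraMap h I _).trans ?_
  rw [inclB_algebraMap]
  rfl

theorem toFrac_inclA_mem_closure {i m : ℕ} (h : i ≤ m) (I : Ideal (B P m)) [I.IsPrime]
    (s : Set (A K n m)) (hsK : Set.range (algebraMap K (A K n m)) ⊆ s)
    (hsX : ∀ (v : Fin n × ℕ) (hv : v.2 ≤ m), v.2 ≤ i → (⟨X v, X_mem_supported.2 hv⟩ : A K n m) ∈ s)
    (a : A K n i) : toFrac P I (inclA K n h a) ∈ Subfield.closure (toFrac P I '' s) := by
  obtain ⟨a, ha⟩ := a
  refine Algebra.adjoin_induction (p := fun g hg => toFrac P I (inclA K n h ⟨g, hg⟩) ∈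
    Subfield.closure (toFrac P I '' s)) ?_ ?_ ?_ ?_ ha
  · rintro _ ⟨v, hv, rfl⟩
    exact Subfield.subset_closure ⟨_, hsX v (le_trans hv h) hv, rfl⟩
  · intro x
    exact Subfield.subset_closure ⟨_, hsK ⟨x, rfl⟩, rfl⟩
  · intro x y hx hy hx' hy'
    have := add_mem hx' hy'
    rwa [← map_add, ← map_add] at this
  · intro x y hx hy hx' hy'
    have := mul_mem hx' hy'
    rwa [← map_mul, ← map_mul] at this

theorem fracMap_mem_closure {i m : ℕ} (h : i ≤ m) (I : Ideal (B P m)) [I.IsPrime]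
    (s : Set (A K n m)) (hsK : Set.range (algebraMap K (A K n m)) ⊆ s)
    (hsX : ∀ (v : Fin n × ℕ) (hv : v.2 ≤ m), v.2 ≤ i → (⟨X v, X_mem_supported.2 hv⟩ : A K n m) ∈ s)
    (x : FractionRing (B P i ⧸ I.comap (inclB P h))) :
    fracMap h I x ∈ Subfield.closure (toFrac P I '' s) := by
  obtain ⟨a, b, hb, hab⟩ := exists_mul_toFrac_eq _ x
  have hx : x = toFrac P (I.comap (inclB P h)) a / toFrac P (I.comap (inclB P h)) b :=
    (eq_div_iff hb).2 hab
  rw [hx, map_div₀, fracMap_toFrac, fracMap_toFrac]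
  exact div_mem (toFrac_inclA_mem_closure h I s hsK hsX a)
    (toFrac_inclA_mem_closure h I s hsK hsX b)

/-- The transcendence degree of `Frac(B_i / (Δ_{i-e+1+k} ∩ B_i)) ⊆ Frac(B_{i+k} / Δ_{i-e+1+k})` is
the dimension of the kernel of `𝔍_{k,i}`. -/
theorem trdegFrac_eq_finrank_ker [CharZero K] (hP : IsDifferentialIdeal δ P) (hF : ∀ j, F j ∈ P)
    {k i : ℕ} (hi : maxOrder F ≤ i + 1)
    [hprime : (Delta δ F P (i + 1 - maxOrder F + k) (i + k)).IsPrime] :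
    trdegFrac (inclB P (Nat.le_add_right i k)) (Delta δ F P (i + 1 - maxOrder F + k) (i + k)) =
      Module.finrank (FractionRing (B P (i + k) ⧸ Delta δ F P (i + 1 - maxOrder F + k) (i + k)))
        (LinearMap.ker (Matrix.of fun (a : Fin k × Fin r) (b : Fin k × Fin n) =>
          toFrac P (Delta δ F P (i + 1 - maxOrder F + k) (i + k))
            ⟨pseudoJacobian δ F k i a b, pseudoJacobian_mem_A δ F hi le_rfl a b⟩).mulVecLin) := by
  have h : i + 1 - maxOrder F + k + maxOrder F ≤ i + k + 1 := by omega
  let I := Delta δ F P (i + 1 - maxOrder F + k) (i + k)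
  let M := FractionRing (B P i ⧸ I.comap (inclB P (Nat.le_add_right i k)))
  let L := FractionRing (B P (i + k) ⧸ I)
  have : CharZero M := charZero_of_injective_algebraMap (algebraMap K M).injective
  let _ : Algebra M L := (fracMap (Nat.le_add_right i k) I).toAlgebra
  let c : Fin k × Fin n → Fin n × ℕ := fun b => (b.2, i + 1 + b.1)
  have hcm : ∀ b, (c b).2 ≤ i + k := fun b => by
    have := b.1.2
    change i + 1 + (b.1 : ℕ) ≤ i + k
    omega
  have hc : Function.Injective c := by
    rintro ⟨a, b⟩ ⟨a', b'⟩ hab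
    simp only [c, Prod.mk.injEq] at hab
    exact Prod.ext (Fin.ext (by simpa using hab.2)) hab.1
  have hc' : ∀ v : Fin n × ℕ, v.2 ≤ i + k → v ∉ Set.range c → v.2 ≤ i := by
    intro v hv hvc
    by_contra! hlt
    exact hvc ⟨(⟨v.2 - (i + 1), by omega⟩, v.1), Prod.ext rfl (by
      change i + 1 + (v.2 - (i + 1)) = v.2
      omega)⟩
  have key : Algebra.trdeg M L = _ := trdeg_fractionRing_eq_finrank_ker hP hF h c hcm hc ?_ ?_ ?_
  · have hker : LinearMap.ker (Matrix.of fun (a : Fin (i + 1 - maxOrder F + k) × Fin r)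
          (b : Fin k × Fin n) => toFrac P I ⟨pderiv (c b) (derivs δ F h a : DiffPoly K n),
            pderiv_mem_A (derivs δ F h a).2 _⟩).mulVecLin =
        LinearMap.ker (Matrix.of fun (a : Fin k × Fin r) (b : Fin k × Fin n) => toFrac P I
          ⟨pseudoJacobian δ F k i a b, pseudoJacobian_mem_A δ F hi le_rfl a b⟩).mulVecLin := by
      ext w
      rw [LinearMap.mem_ker, LinearMap.mem_ker, Matrix.mulVecLin_apply, Matrix.mulVecLin_apply,
        funext_iff, funext_iff]
      constructor
      · intro hw a
        exact hw (⟨i + 1 - maxOrder F + a.1, by have := a.1.2; omega⟩, a.2)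
      · rintro hw ⟨⟨p, hp⟩, j⟩
        rcases lt_or_ge p (i + 1 - maxOrder F) with hlt | hge
        · refine Finset.sum_eq_zero fun b _ => mul_eq_zero_of_left ?_ _
          have hzero : pderiv (c b) (iterDeriv δ p (F j)) = 0 :=
            pderiv_eq_zero_of_mem_A (m := i) (iterDeriv_mem_A δ F j (by omega))
              (show i < i + 1 + (b.1 : ℕ) by omega)
          exact (congrArg (toFrac P I) (Subtype.ext hzero)).trans (map_zero (toFrac P I))
        · obtain ⟨p, rfl⟩ := Nat.exists_eq_add_of_le hge
          exact hw (⟨p, by omega⟩, j)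
    rw [← hker]
    exact key
  · intro x
    refine fracMap_mem_closure (Nat.le_add_right i k) I _ Set.subset_union_left ?_ x
    intro v hv hvi
    refine Or.inr ⟨v, ?_, rfl⟩
    rintro ⟨b, rfl⟩
    have : i + 1 + (b.1 : ℕ) ≤ i := hvi
    omega
  · intro x
    exact ⟨_, fracMap_toFrac (Nat.le_add_right i k) I (algebraMap K (A K n i) x)⟩
  · intro v hvc hv
    have hvi := hc' v (X_mem_supported (R := K) (s := {v : Fin n × ℕ | v.2 ≤ i + k}).1 hv) hvc
    exact ⟨_, fracMap_toFrac (Nat.le_add_right i k) I ⟨X v, X_mem_supported.2 hvi⟩⟩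

/-- The kernel has dimension `kn - rank`, and the rank equals `kr - μ` because it can be computed
over the residue field of `P`. -/
theorem trdegFrac_eq [CharZero K] (hrn : r ≤ n) (hmin : IsMinimalPrimeDifferential δ F P)
    (hreg : IsQuasiRegular δ F P) (hrank : HasConstantRanks δ F P) {k i : ℕ}
    (hi : maxOrder F ≤ i + 1)
    [hprime : (Delta δ F P (i + 1 - maxOrder F + k) (i + k)).IsPrime] :
    trdegFrac (inclB P (Nat.le_add_right i k)) (Delta δ F P (i + 1 - maxOrder F + k) (i + k)) =
      ((k * (n - r) + mu δ F P k i : ℕ) : Cardinal) := by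
  obtain ⟨-, hP, hF⟩ := hmin.1
  rw [trdegFrac_eq_finrank_ker hP hF hi]
  congr 1
  let I := Delta δ F P (i + 1 - maxOrder F + k) (i + k)
  let J : Matrix (Fin k × Fin r) (Fin k × Fin n) (B P (i + k) ⧸ I) := fun a b =>
    Ideal.Quotient.mk _ (algebraMap (A K n (i + k)) (B P (i + k))
        ⟨pseudoJacobian δ F k i a b, pseudoJacobian_mem_A δ F hi le_rfl a b⟩)
  have h0 : rankMod δ F P k i 0 hi = J.rank := rfl
  have h1 : (J.map (algebraMap (B P (i + k) ⧸ I) (FractionRing (B P (i + k) ⧸ I)))).rank = J.rank :=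
    Matrix.rank_map_of_injective _ (IsFractionRing.injective _ _) J
  have h2 := LinearMap.finrank_range_add_finrank_ker
    (J.map (algebraMap (B P (i + k) ⧸ I) (FractionRing (B P (i + k) ⧸ I)))).mulVecLin
  have h3 := rank_residueField_eq_rankMod hmin hreg hrank (k := k) hi
  have h4 := rank_add_mu (δ := δ) (F := F) (P := P) k i
  rw [Module.finrank_fintype_fun_eq_card, Fintype.card_prod, Fintype.card_fin,
    Fintype.card_fin] at h2
  change Matrix.rank _ + _ = _ at h2
  rw [h1, ← h0, ← h3] at h2
  refine Eq.trans (b := Module.finrank (FractionRing (B P (i + k) ⧸ I)) (LinearMap.ker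
    (J.map (algebraMap (B P (i + k) ⧸ I) (FractionRing (B P (i + k) ⧸ I)))).mulVecLin)) rfl ?_
  obtain ⟨d, rfl⟩ := Nat.exists_eq_add_of_le hrn
  rw [Nat.add_sub_cancel_left]
  rw [mul_add] at h2
  omega

theorem trdeg_comap_add_trdegFrac {i m : ℕ} (h : i ≤ m) (I : Ideal (B P m)) [I.IsPrime] :
    Algebra.trdeg K (FractionRing (B P i ⧸ I.comap (inclB P h))) + trdegFrac (inclB P h) I =
      Algebra.trdeg K (FractionRing (B P m ⧸ I)) := by
  exact trdeg_add_trdeg_of_ringHom (fracMap h I) fun x =>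
    fracMap_toFrac h I (algebraMap K (A K n i) x)

end Tower

end DAE

end

/-! ### Assembly of the two transcendence degree formulas. -/

theorem proposition3p2 {K : Type*} [Field K] [CharZero K] (δ : Derivation ℤ K K)
    {n r : ℕ} (hrn : r ≤ n) (F : Fin r → DAE.DiffPoly K n)
    (e : ℕ) (he : e = DAE.maxOrder F) (he1 : 1 ≤ e)
    (P : Ideal (DAE.DiffPoly K n)) [P.IsPrime]
    (hmin : DAE.IsMinimalPrimeDifferential δ F P)
    (hreg : DAE.IsQuasiRegular δ F P)
    (hrank : DAE.HasConstantRanks δ F P)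
    (k i : ℕ) (hi : e ≤ i + 1) :
    ∃ _hprime : (DAE.Delta δ F P (i + 1 - e + k) (i + k)).IsPrime,
      DAE.trdegFrac (DAE.inclB P (Nat.le_add_right i k))
          (DAE.Delta δ F P (i + 1 - e + k) (i + k)) =
        ((k * (n - r) + DAE.mu δ F P k i : ℕ) : Cardinal) ∧
      ∃ d : ℕ,
        Algebra.trdeg K (FractionRing (DAE.B P i ⧸
          (DAE.Delta δ F P (i + 1 - e + k) (i + k)).comap
            (DAE.inclB P (Nat.le_add_right i k)))) = (d : Cardinal) ∧
        (d : ℤ) = ((n : ℤ) - r) * (i + 1) + e * r - DAE.mu δ F P k i := by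
  subst he
  obtain ⟨-, hP, hF⟩ := hmin.1
  have hqm : i + 1 - DAE.maxOrder F + k + DAE.maxOrder F ≤ i + k + 1 := by omega
  have hprime := DAE.Delta_isPrime hP hF hreg hqm
  have h1 := DAE.trdegFrac_eq hrn hmin hreg hrank (k := k) hi
  refine ⟨hprime, h1, ?_⟩
  have h2 := DAE.trdeg_comap_add_trdegFrac (Nat.le_add_right i k)
    (DAE.Delta δ F P (i + 1 - DAE.maxOrder F + k) (i + k))
  obtain ⟨t, h3, h4⟩ := DAE.trdeg_fractionRing hP hF hreg hqm
  rw [h1, h3] at h2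
  -- The lower degree is finite, being at most the total degree `t`; cardinal additivity then
  -- becomes an equation of natural numbers.
  obtain ⟨d, hd⟩ := Cardinal.lt_aleph0.1 ((self_le_add_right _ _).trans_lt
    (h2.trans_lt (Cardinal.natCast_lt_aleph0 (n := t))))
  refine ⟨d, hd, ?_⟩
  rw [hd] at h2
  have h5 : d + (k * (n - r) + DAE.mu δ F P k i) = t := by exact_mod_cast h2
  obtain ⟨c, rfl⟩ := Nat.exists_eq_add_of_le hrn
  -- Here `b = i + 1 - e`; naming it removes truncated subtraction before passing to the integers.
  obtain ⟨b, hb⟩ := Nat.exists_eq_add_of_le hi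
  rw [Nat.add_sub_cancel_left] at h5
  have h6 : i + 1 - DAE.maxOrder F + k = b + k := by omega
  rw [h6] at h4
  have h7 : (i : ℤ) + 1 = DAE.maxOrder F + b := by exact_mod_cast hb
  zify at h4 h5
  push_cast
  linear_combination h5 + h4 + (r : ℤ) * h7
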